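/- Let $U\subset\mathbb R^2$ be a non-empty connected open set with coordinates $(t^1,t^2)$. Let $H=(h_{kl})$ be a smooth symmetric $2\times2$ matrix function on $U$, let $F_i=(f_i^1\ f_i^2)$, $i=1,2$, be smooth row-vector functions on $U$, let $q$ be a smooth nowhere zero function on $U$, and let $\Lambda\in\mathbb R$. On $U\times\mathbb R^2$, with coordinates $(t^1,t^2,z^1,z^2)$, consider the metric $$ \mathbf g=\tilde g_{ij}\,dt^i\,dt^j+h_{kl}\,(dz^k+f_i^k\,dt^i)(dz^l+f_j^l\,dt^j),\qquad \tilde{\mathbf g}=\begin{pmatrix}0&q\\ q&0\end{pmatrix} $$ (so $\det\tilde{\mathbf g}<0$). Assume that everywhere on $U$ $$ \det H>0,\qquad C_\rho:=\frac{\tilde g^{ij}(\det H)_{,i}(\det H)_{,j}}{(\det H)^2}\neq0 . $$ Put $r=\sqrt{\det H}$, let $E$ be the $2\times2$ unit matrix, let a comma denote partial differentiation, let $\ln x$ mean $\ln|x|$, and let $\mathbf R_{\mu\nu}$ be the Ricci tensor of $\mathbf g$ (with the sign for which round spheres have positive Ricci curvature). Then: 1. The $\Lambda$-vacuum Einstein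 equations $\mathbf R_{\mu\nu}-\Lambda\,\mathbf g_{\mu\nu}=0$ hold on $U\times\mathbb R^2$ if and only if there is a constant row vector $A=(a_1\ a_2)$ such that on $U$ $$ \begin{gathered} (rH_{,1}H^{-1})_{,2}+(rH_{,2}H^{-1})_{,1}=-2\Lambda qr\,E-\frac qr\,A^\top A\,H^{-1},\\ (\ln q)_{,1}=(\ln(\ln r)_{,1})_{,1}+\frac{\operatorname{tr}(H_{,1}H^{-1}H_{,1}H^{-1})}{4(\ln r)_{,1}},\\ (\ln q)_{,2}=(\ln(\ln r)_{,2})_{,2}+\frac{\operatorname{tr}(H_{,2}H^{-1}H_{,2}H^{-1})}{4(\ln r)_{,2}},\\ F_{1,2}-F_{2,1}=\frac qr\,A\,H^{-1}. \end{gathered} $$ 2. Whenever this system holds with the constant row vector $A$, one has $A=0$ if and only if the distribution $\Xi^\perp$, the $\mathbf g$-orthogonal complement of $\Xi=\langle\partial_{z^1},\partial_{z^2}\rangle$, is completely integrable. 3. The system is compatible: for every constant row vector $A$, the cross-derivative condition $(\ln q)_{,12}=(\ln q)_{,21}$ for the second and third equations is an algebraic consequence of the system and the first derivatives of its first equation.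 That is, if $H,q$ are as above and at a point $t\in U$ the first equation, its first-order partial derivatives, and the second and third equations hold, then at $t$ the $t^2$-derivative of the right-hand side of the second equation equals the $t^1$-derivative of the right-hand side of the third. 4. For every constant row vector $A$, at each point of $U$ where the first equation of the system holds, $$ r_{,12}=-\Lambda qr-\frac q{4r}\,A\,H^{-1}A^\top . $$ -/

import Mathlib

open scoped Matrix ContDiff

noncomputable section

namespace G2Metric

/-! ### Differential geometry in a coordinate domain of `ι → ℝ` -/

/-- The partial derivative `∂f/∂xⁱ` at `x`. -/
def pd {ι : Type*} [Fintype ι] [DecidableEq ι] (i : ι) (f : (ι → ℝ) → ℝ) (x : ι → ℝ) : ℝ :=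
  fderiv ℝ f x (Pi.single i 1)

/-- The entrywise partial derivative of a matrix-valued function. -/
def matPd {ι m n : Type*} [Fintype ι] [DecidableEq ι] (i : ι) (M : (ι → ℝ) → Matrix m n ℝ)
    (x : ι → ℝ) : Matrix m n ℝ :=
  Matrix.of fun k l => pd i (fun s => M s k l) x

/-- The Christoffel symbols `Γᵃ_{bc}` of the metric `g`. -/
def christoffel {ι : Type*} [Fintype ι] [DecidableEq ι] (g : (ι → ℝ) → Matrix ι ι ℝ)
    (a b c : ι) (x : ι → ℝ) : ℝ :=
  (1 / 2) * ∑ d, (g x)⁻¹ a d *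
    (pd b (fun y => g y d c) x + pd c (fun y => g y d b) x - pd d (fun y => g y b c) x)

/-- The Ricci tensor
`R_{bc} = ∂_a Γᵃ_{bc} - ∂_c Γᵃ_{ba} + Γᵃ_{ad} Γᵈ_{bc} - Γᵃ_{cd} Γᵈ_{ba}`
(positive for round spheres). -/
def ricci {ι : Type*} [Fintype ι] [DecidableEq ι] (g : (ι → ℝ) → Matrix ι ι ℝ)
    (b c : ι) (x : ι → ℝ) : ℝ :=
  ∑ a, (pd a (christoffel g a b c) x - pd c (christoffel g a b a) x
    + ∑ d, (christoffel g a a d x * christoffel g d b c x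
      - christoffel g a c d x * christoffel g d b a x))

/-- The `Λ`-vacuum Einstein equations `R_{μν} - Λ g_{μν} = 0` on `M`. -/
def IsLambdaVacuum {ι : Type*} [Fintype ι] [DecidableEq ι] (Λ : ℝ)
    (g : (ι → ℝ) → Matrix ι ι ℝ) (M : Set (ι → ℝ)) : Prop :=
  ∀ x ∈ M, ∀ μ ν, ricci g μ ν x - Λ * g x μ ν = 0

/-- A distribution on the open set `M` is completely integrable if every point of `M` has an open
neighbourhood on which the distribution is tangent to the level sets of a smooth submersion. -/
def IsCompletelyIntegrable {ι : Type*} [Fintype ι]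
    (M : Set (ι → ℝ)) (D : (ι → ℝ) → Submodule ℝ (ι → ℝ)) : Prop :=
  ∀ p ∈ M, ∃ V : Set (ι → ℝ), IsOpen V ∧ p ∈ V ∧ V ⊆ M ∧
    ∃ (m : ℕ) (y : (ι → ℝ) → (Fin m → ℝ)), ContDiffOn ℝ ∞ y V ∧
      ∀ x ∈ V, Function.Surjective (fderiv ℝ y x) ∧
        D x = LinearMap.ker (fderiv ℝ y x : (ι → ℝ) →ₗ[ℝ] (Fin m → ℝ))

/-! ### Metrics with two commuting Killing fields

The adapted coordinates are indexed by `Fin 2 ⊕ Fin 2`: the index `Sum.inl i` stands for `tⁱ` and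
`Sum.inr k` for `zᵏ` (indices `0, 1` in place of `1, 2`). -/

/-- The projection `(t, z) ↦ t` onto the orbit space. -/
def proj (x : Fin 2 ⊕ Fin 2 → ℝ) : Fin 2 → ℝ := fun i => x (Sum.inl i)

/-- The metric
`g = g̃_{ij} dtⁱ dtʲ + h_{kl} (dzᵏ + f_iᵏ dtⁱ) (dzˡ + f_jˡ dtʲ)`, where `F t i k = f_iᵏ(t)`. -/
def metric (gt H F : (Fin 2 → ℝ) → Matrix (Fin 2) (Fin 2) ℝ) (x : Fin 2 ⊕ Fin 2 → ℝ) :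
    Matrix (Fin 2 ⊕ Fin 2) (Fin 2 ⊕ Fin 2) ℝ :=
  Matrix.fromBlocks
    (gt (proj x) + F (proj x) * H (proj x) * (F (proj x))ᵀ) (F (proj x) * H (proj x))
    (F (proj x) * H (proj x))ᵀ (H (proj x))

/-- The tangent space `Ξ` of the Killing leaves, spanned by `∂/∂z¹, ∂/∂z²`. -/
def killingSpan : Submodule ℝ (Fin 2 ⊕ Fin 2 → ℝ) :=
  Submodule.span ℝ (Set.range fun k : Fin 2 => Pi.single (Sum.inr k) 1)

/-- The distribution `Ξ^⊥`, orthogonal to the Killing leaves with respect to `g`. -/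
def orthDistribution (g : (Fin 2 ⊕ Fin 2 → ℝ) → Matrix (Fin 2 ⊕ Fin 2) (Fin 2 ⊕ Fin 2) ℝ)
    (x : Fin 2 ⊕ Fin 2 → ℝ) : Submodule ℝ (Fin 2 ⊕ Fin 2 → ℝ) :=
  (Matrix.toBilin' (g x)).orthogonal killingSpan

/-- The invariant `C_ρ = g̃^{ij} (det H)_{,i} (det H)_{,j} / (det H)²`. -/
def cRho (gt H : (Fin 2 → ℝ) → Matrix (Fin 2) (Fin 2) ℝ) (t : Fin 2 → ℝ) : ℝ :=
  1 / (H t).det ^ 2 * ∑ i, ∑ j,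
    pd i (fun s => (H s).det) t * pd j (fun s => (H s).det) t * (gt t)⁻¹ i j

/-- The orbit metric in null form. -/
def nullForm (q : (Fin 2 → ℝ) → ℝ) (t : Fin 2 → ℝ) : Matrix (Fin 2) (Fin 2) ℝ :=
  !![0, q t; q t, 0]

/-! ### The reduced system -/

/-- `r = √(det H)`. -/
def rad (H : (Fin 2 → ℝ) → Matrix (Fin 2) (Fin 2) ℝ) (t : Fin 2 → ℝ) : ℝ := √(H t).det

/-- The matrix `(r H_{,1} H⁻¹)_{,2} + (r H_{,2} H⁻¹)_{,1} + 2 Λ q r E + (q / r) Aᵀ A H⁻¹`. -/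
def matrixResidual (Λ : ℝ) (H : (Fin 2 → ℝ) → Matrix (Fin 2) (Fin 2) ℝ) (q : (Fin 2 → ℝ) → ℝ)
    (A : Fin 2 → ℝ) (t : Fin 2 → ℝ) : Matrix (Fin 2) (Fin 2) ℝ :=
  matPd 1 (fun s => rad H s • (matPd 0 H s * (H s)⁻¹)) t
    + matPd 0 (fun s => rad H s • (matPd 1 H s * (H s)⁻¹)) t
    + (2 * Λ * q t * rad H t) • (1 : Matrix (Fin 2) (Fin 2) ℝ)
    + (q t / rad H t) • (Matrix.vecMulVec A A * (H t)⁻¹)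

/-- The matrix equation at the point `t`. -/
def MatrixEq (Λ : ℝ) (H : (Fin 2 → ℝ) → Matrix (Fin 2) (Fin 2) ℝ) (q : (Fin 2 → ℝ) → ℝ)
    (A : Fin 2 → ℝ) (t : Fin 2 → ℝ) : Prop :=
  matPd 1 (fun s => rad H s • (matPd 0 H s * (H s)⁻¹)) t
      + matPd 0 (fun s => rad H s • (matPd 1 H s * (H s)⁻¹)) t
    = -((2 * Λ * q t * rad H t) • (1 : Matrix (Fin 2) (Fin 2) ℝ))
      - (q t / rad H t) • (Matrix.vecMulVec A A * (H t)⁻¹)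

/-- The right-hand side `(ln (ln r)_{,i})_{,i} + tr (H_{,i} H⁻¹ H_{,i} H⁻¹) / (4 (ln r)_{,i})` of
the scalar equation for `(ln q)_{,i}`. Note that `Real.log x = ln |x|` for `x ≠ 0`. -/
def scalarRhs (H : (Fin 2 → ℝ) → Matrix (Fin 2) (Fin 2) ℝ) (i : Fin 2) (t : Fin 2 → ℝ) : ℝ :=
  pd i (fun s => Real.log (pd i (fun u => Real.log (rad H u)) s)) t
    + (matPd i H t * (H t)⁻¹ * matPd i H t * (H t)⁻¹).trace
      / (4 * pd i (fun u => Real.log (rad H u)) t)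

/-- The scalar equation for `(ln q)_{,i}` at the point `t`. -/
def ScalarEq (H : (Fin 2 → ℝ) → Matrix (Fin 2) (Fin 2) ℝ) (q : (Fin 2 → ℝ) → ℝ)
    (i : Fin 2) (t : Fin 2 → ℝ) : Prop :=
  pd i (fun s => Real.log (q s)) t = scalarRhs H i t

/-- The equation `F_{1,2} - F_{2,1} = (q / r) A H⁻¹` between row vectors at the point `t`. -/
def TwistEq (H F : (Fin 2 → ℝ) → Matrix (Fin 2) (Fin 2) ℝ) (q : (Fin 2 → ℝ) → ℝ)
    (A : Fin 2 → ℝ) (t : Fin 2 → ℝ) : Prop :=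
  (fun k => pd 1 (fun s => F s 0 k) t - pd 0 (fun s => F s 1 k) t)
    = (q t / rad H t) • (A ᵥ* (H t)⁻¹)

/-- The full system of matrix and scalar equations on `U`, with constant row vector `A`. -/
def ReducedSystem (Λ : ℝ) (H F : (Fin 2 → ℝ) → Matrix (Fin 2) (Fin 2) ℝ)
    (q : (Fin 2 → ℝ) → ℝ) (A : Fin 2 → ℝ) (U : Set (Fin 2 → ℝ)) : Prop :=
  ∀ t ∈ U, MatrixEq Λ H q A t ∧ ScalarEq H q 0 t ∧ ScalarEq H q 1 t ∧ TwistEq H F q A t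

/-- Compatibility of the system at the point `t`. The system can be solved for the leading
derivatives `H_{,12}`, `q_{,1}`, `q_{,2}`, `F_{1,2}`, so its only integrability condition is the
equality of the two values of `(ln q)_{,12}` obtained by differentiating the two scalar equations.
This equality has to be an algebraic consequence, at the single point `t`, of the matrix equation,
its first derivatives, and the two scalar equations; the scalar equations are not assumed at other
points, so that the symmetry of second derivatives of `q` does not give it for free. -/
def CompatibleAt (Λ : ℝ) (H : (Fin 2 → ℝ) → Matrix (Fin 2) (Fin 2) ℝ)
    (q : (Fin 2 → ℝ) → ℝ) (A : Fin 2 → ℝ) (t : Fin 2 → ℝ) : Prop :=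
  MatrixEq Λ H q A t → (∀ i, matPd i (matrixResidual Λ H q A) t = 0) →
    ScalarEq H q 0 t → ScalarEq H q 1 t → pd 1 (scalarRhs H 0) t = pd 0 (scalarRhs H 1) t

end G2Metric

/-!
The components of the metric depend on `t` only, and a shear `z ↦ z + Cᵀ t` replaces `F` by `F - C`.
So the Ricci tensor at a point may be computed in coordinates in which `F` vanishes there, where it
is an algebraic function of the 2-jet of `H`, `F`, `q`.

The mixed components of the Einstein equations then say that the twist density
`(r / q) (F_{1,2} - F_{2,1}) H` has vanishing derivative; on the connected set `U` it is a constant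
vector `A`. Given this, the vertical block is the matrix equation and the two diagonal components of
the horizontal block are the scalar equations. The trace of the matrix equation is the formula for
`r_{,12}`. Differentiating the latter along `t¹` and `t²` shows that the remaining off-diagonal
component follows from the other equations, and also that the scalar equations are compatible.

The distribution `Ξ^⊥` is the common kernel of the forms `dzᵏ + f_iᵏ dtⁱ`. It is integrable if and
only if these forms are closed, that is, if and only if the twist vanishes.
-/

open Filter Topology

noncomputable section

namespace G2Metric

/-! ### Calculus of partial derivatives -/

section PartialDerivatives

variable {ι : Type*} [Fintype ι] [DecidableEq ι] {i j : ι} {f g : (ι → ℝ) → ℝ} {x : ι → ℝ}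
  {U : Set (ι → ℝ)}

theorem pd_congr (h : f =ᶠ[𝓝 x] g) : pd i f x = pd i g x := by
  rw [pd, pd, h.fderiv_eq]

theorem pd_congr_on (hU : IsOpen U) (h : Set.EqOn f g U) (hx : x ∈ U) : pd i f x = pd i g x :=
  pd_congr (h.eventuallyEq_of_mem (hU.mem_nhds hx))

@[simp] theorem pd_const (c : ℝ) : pd i (fun _ : ι → ℝ => c) x = 0 := by
  simp [pd]

theorem pd_add (hf : DifferentiableAt ℝ f x) (hg : DifferentiableAt ℝ g x) :
    pd i (fun y => f y + g y) x = pd i f x + pd i g x := by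
  simp [pd, fderiv_fun_add hf hg]

theorem pd_sub (hf : DifferentiableAt ℝ f x) (hg : DifferentiableAt ℝ g x) :
    pd i (fun y => f y - g y) x = pd i f x - pd i g x := by
  simp [pd, fderiv_fun_sub hf hg]

theorem pd_mul (hf : DifferentiableAt ℝ f x) (hg : DifferentiableAt ℝ g x) :
    pd i (fun y => f y * g y) x = pd i f x * g x + f x * pd i g x := by
  simp only [pd, fderiv_fun_mul hf hg, add_apply, smul_apply, smul_eq_mul]
  ring

theorem pd_const_mul (c : ℝ) (hf : DifferentiableAt ℝ f x) :
    pd i (fun y => c * f y) x = c * pd i f x := by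
  simp [pd, fderiv_const_mul hf]

theorem pd_sum {κ : Type*} {s : Finset κ} {f : κ → (ι → ℝ) → ℝ}
    (hf : ∀ k ∈ s, DifferentiableAt ℝ (f k) x) :
    pd i (fun y => ∑ k ∈ s, f k y) x = ∑ k ∈ s, pd i (f k) x := by
  simp [pd, fderiv_fun_sum hf]

theorem pd_prod {κ : Type*} [DecidableEq κ] {s : Finset κ} {f : κ → (ι → ℝ) → ℝ}
    (hf : ∀ k ∈ s, DifferentiableAt ℝ (f k) x) :
    pd i (fun y => ∏ k ∈ s, f k y) x = ∑ k ∈ s, (∏ l ∈ s.erase k, f l x) * pd i (f k) x := by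
  simp [pd, fderiv_finsetProd hf]

theorem pd_comp_deriv {φ : ℝ → ℝ} {φ' : ℝ} (hφ : HasDerivAt φ φ' (f x))
    (hf : DifferentiableAt ℝ f x) : pd i (fun y => φ (f y)) x = φ' * pd i f x := by
  have h : fderiv ℝ (fun y => φ (f y)) x = φ' • fderiv ℝ f x :=
    (hφ.comp_hasFDerivAt x hf.hasFDerivAt).fderiv
  simp [pd, h]

theorem pd_div (hf : DifferentiableAt ℝ f x) (hg : DifferentiableAt ℝ g x) (h0 : g x ≠ 0) :
    pd i (fun y => f y / g y) x = (pd i f x * g x - f x * pd i g x) / g x ^ 2 := by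
  simp only [div_eq_mul_inv]
  rw [pd_mul hf (hg.fun_inv h0), pd_comp_deriv (hasDerivAt_inv h0) hg]
  field_simp
  ring

theorem pd_log (hf : DifferentiableAt ℝ f x) (h0 : f x ≠ 0) :
    pd i (fun y => Real.log (f y)) x = pd i f x / f x := by
  rw [pd_comp_deriv (Real.hasDerivAt_log h0) hf, inv_mul_eq_div]

theorem pd_sqrt (hf : DifferentiableAt ℝ f x) (h0 : f x ≠ 0) :
    pd i (fun y => √(f y)) x = pd i f x / (2 * √(f x)) := by
  rw [pd_comp_deriv (Real.hasDerivAt_sqrt h0) hf, one_div_mul_eq_div]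

theorem fderiv_eq_sum_pd (v : ι → ℝ) : fderiv ℝ f x v = ∑ k, v k * pd k f x := by
  conv_lhs => rw [pi_eq_sum_univ' v, map_sum]
  simp only [map_smul, smul_eq_mul, pd]

theorem pd_comp_mulVec {κ : Type*} [Fintype κ] [DecidableEq κ] (L : Matrix ι κ ℝ) {y : κ → ℝ}
    (hf : DifferentiableAt ℝ f (L *ᵥ y)) (k : κ) :
    pd k (fun z => f (L *ᵥ z)) y = ∑ i, L i k * pd i f (L *ᵥ y) := by
  have h : fderiv ℝ (fun z => f (L *ᵥ z)) y
      = (fderiv ℝ f (L *ᵥ y)).comp (Matrix.mulVecLin L).toContinuousLinearMap :=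
    (hf.hasFDerivAt.comp y (Matrix.mulVecLin L).toContinuousLinearMap.hasFDerivAt).fderiv
  rw [pd, h, ContinuousLinearMap.comp_apply, fderiv_eq_sum_pd]
  simp

theorem contDiffOn_pd (hU : IsOpen U) (hf : ContDiffOn ℝ ∞ f U) (i : ι) :
    ContDiffOn ℝ ∞ (pd i f) U :=
  (hf.fderiv_of_isOpen hU (by simp)).clm_apply contDiffOn_const

theorem pd_comm (hU : IsOpen U) (hf : ContDiffOn ℝ ∞ f U) (hx : x ∈ U) :
    pd i (pd j f) x = pd j (pd i f) x := by
  have hsymm : IsSymmSndFDerivAt ℝ f x :=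
    (hf.contDiffAt (hU.mem_nhds hx)).isSymmSndFDerivAt
      (minSmoothness_of_isRCLikeNormedField.trans_le (WithTop.coe_le_coe.2 le_top))
  have hdiff : DifferentiableAt ℝ (fderiv ℝ f) x :=
    ((hf.fderiv_of_isOpen hU (m := ∞) (by simp)).contDiffAt
      (hU.mem_nhds hx)).differentiableAt (by simp)
  have pd_pd (a b : ι) :
      pd a (pd b f) x = fderiv ℝ (fderiv ℝ f) x (Pi.single a 1) (Pi.single b 1) := by
    change fderiv ℝ (fun y => fderiv ℝ f y (Pi.single b 1)) x (Pi.single a 1) = _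
    rw [fderiv_clm_apply hdiff (by fun_prop)]
    simp
  rw [pd_pd, pd_pd, hsymm.eq]

end PartialDerivatives

/-! ### Calculus of matrix functions -/

section MatrixCalculus

variable {E : Type*} [NormedAddCommGroup E] [NormedSpace ℝ E] {l m n : Type*}

/-- Entrywise differentiability at a point. Matrices carry no canonical norm, so that
`DifferentiableAt` does not apply to matrix functions. -/
def MatDifferentiableAt (A : E → Matrix m n ℝ) (x : E) : Prop :=
  ∀ k l, DifferentiableAt ℝ (fun s => A s k l) x

/-- Entrywise smoothness on a set. -/
def MatSmoothOn (A : E → Matrix m n ℝ) (U : Set E) : Prop :=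
  ∀ k l, ContDiffOn ℝ ∞ (fun s => A s k l) U

section Regularity

variable {A B : E → Matrix m n ℝ} {f : E → ℝ} {x : E} {U : Set E}

theorem matSmoothOn_const (C : Matrix m n ℝ) : MatSmoothOn (fun _ => C) U :=
  fun _ _ => contDiffOn_const

theorem matDifferentiableAt_const (C : Matrix m n ℝ) : MatDifferentiableAt (fun _ => C) x :=
  fun _ _ => differentiableAt_const _

theorem MatDifferentiableAt.transpose (hA : MatDifferentiableAt A x) :
    MatDifferentiableAt (fun s => (A s)ᵀ) x :=
  fun k l => hA l k

theorem MatDifferentiableAt.add (hA : MatDifferentiableAt A x) (hB : MatDifferentiableAt B x) :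
    MatDifferentiableAt (fun s => A s + B s) x :=
  fun k l => (hA k l).fun_add (hB k l)

theorem MatDifferentiableAt.const_smul (c : ℝ) (hA : MatDifferentiableAt A x) :
    MatDifferentiableAt (fun s => c • A s) x :=
  fun k l => (hA k l).const_mul c

theorem MatDifferentiableAt.sum {κ : Type*} {s : Finset κ} {A : κ → E → Matrix m n ℝ}
    (hA : ∀ c ∈ s, MatDifferentiableAt (A c) x) :
    MatDifferentiableAt (fun y => ∑ c ∈ s, A c y) x := by
  intro k l
  simp only [Matrix.sum_apply]
  exact DifferentiableAt.fun_sum fun c hc => hA c hc k l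

theorem MatDifferentiableAt.mul [Fintype m] {A : E → Matrix l m ℝ}
    (hA : MatDifferentiableAt A x) (hB : MatDifferentiableAt B x) :
    MatDifferentiableAt (fun s => A s * B s) x := by
  intro k l
  simp only [Matrix.mul_apply]
  exact DifferentiableAt.fun_sum fun c _ => (hA k c).fun_mul (hB c l)

theorem MatDifferentiableAt.comp_mulVec {ι κ : Type*} [Fintype ι] [Fintype κ]
    {A : (ι → ℝ) → Matrix m n ℝ} (L : Matrix ι κ ℝ) {y : κ → ℝ}
    (hA : MatDifferentiableAt A (L *ᵥ y)) : MatDifferentiableAt (fun z => A (L *ᵥ z)) y :=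
  fun k l => (hA k l).comp y (Matrix.mulVecLin L).toContinuousLinearMap.differentiableAt

theorem MatSmoothOn.matDifferentiableAt (hA : MatSmoothOn A U) (hU : IsOpen U) (hx : x ∈ U) :
    MatDifferentiableAt A x :=
  fun k l => ((hA k l).contDiffAt (hU.mem_nhds hx)).differentiableAt (by simp)

theorem MatSmoothOn.transpose (hA : MatSmoothOn A U) : MatSmoothOn (fun s => (A s)ᵀ) U :=
  fun k l => hA l k

theorem MatSmoothOn.add (hA : MatSmoothOn A U) (hB : MatSmoothOn B U) :
    MatSmoothOn (fun s => A s + B s) U :=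
  fun k l => (hA k l).add (hB k l)

theorem MatSmoothOn.sub (hA : MatSmoothOn A U) (hB : MatSmoothOn B U) :
    MatSmoothOn (fun s => A s - B s) U :=
  fun k l => (hA k l).sub (hB k l)

theorem MatSmoothOn.smul (hf : ContDiffOn ℝ ∞ f U) (hA : MatSmoothOn A U) :
    MatSmoothOn (fun s => f s • A s) U :=
  fun k l => hf.mul (hA k l)

theorem MatSmoothOn.const_smul (c : ℝ) (hA : MatSmoothOn A U) :
    MatSmoothOn (fun s => c • A s) U :=
  fun k l => (hA k l).const_smul c

theorem MatSmoothOn.mul [Fintype m] {A : E → Matrix l m ℝ} (hA : MatSmoothOn A U)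
    (hB : MatSmoothOn B U) : MatSmoothOn (fun s => A s * B s) U := by
  intro k l
  simp only [Matrix.mul_apply]
  exact ContDiffOn.sum fun c _ => (hA k c).mul (hB c l)

theorem MatSmoothOn.trace [Fintype n] {A : E → Matrix n n ℝ} (hA : MatSmoothOn A U) :
    ContDiffOn ℝ ∞ (fun s => (A s).trace) U :=
  ContDiffOn.sum fun k _ => hA k k

theorem MatSmoothOn.det [Fintype n] [DecidableEq n] {A : E → Matrix n n ℝ}
    (hA : MatSmoothOn A U) : ContDiffOn ℝ ∞ (fun s => (A s).det) U := by
  simp only [Matrix.det_apply]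
  exact ContDiffOn.sum fun σ _ => (contDiffOn_prod fun a _ => hA _ _).const_smul _

theorem MatSmoothOn.inv [Fintype n] [DecidableEq n] {A : E → Matrix n n ℝ}
    (hA : MatSmoothOn A U) (hdet : ∀ s ∈ U, (A s).det ≠ 0) : MatSmoothOn (fun s => (A s)⁻¹) U := by
  intro a b
  have cramer (s : E) :
      (A s)⁻¹ a b = ((A s).det)⁻¹ * ((A s).updateRow b (Pi.single a 1)).det := by
    rw [Matrix.inv_def, Ring.inverse_eq_inv', Matrix.smul_apply, Matrix.adjugate_apply, smul_eq_mul]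
  simp only [cramer]
  refine (hA.det.inv hdet).mul (MatSmoothOn.det fun c d => ?_)
  by_cases h : c = b
  · subst h; simpa using contDiffOn_const
  · simpa [Matrix.updateRow_apply, h] using hA c d

end Regularity

section MatPd

variable {ι : Type*} [Fintype ι] [DecidableEq ι] {A B : (ι → ℝ) → Matrix m n ℝ}
  {f : (ι → ℝ) → ℝ} {x : ι → ℝ} {U : Set (ι → ℝ)} {i j : ι}

theorem MatSmoothOn.matPd (hA : MatSmoothOn A U) (hU : IsOpen U) (i : ι) :
    MatSmoothOn (matPd i A) U :=
  fun k l => contDiffOn_pd hU (hA k l) i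

theorem matPd_congr_on (hU : IsOpen U) (h : Set.EqOn A B U) (hx : x ∈ U) :
    matPd i A x = matPd i B x := by
  ext k l
  exact pd_congr_on hU (fun s hs => congrFun₂ (h hs) k l) hx

@[simp] theorem matPd_const (C : Matrix m n ℝ) : matPd i (fun _ => C) x = 0 := by
  ext k l
  exact pd_const (C k l)

theorem matPd_transpose : matPd i (fun s => (A s)ᵀ) x = (matPd i A x)ᵀ := rfl

theorem matPd_add (hA : MatDifferentiableAt A x) (hB : MatDifferentiableAt B x) :
    matPd i (fun s => A s + B s) x = matPd i A x + matPd i B x := by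
  ext k l
  exact pd_add (hA k l) (hB k l)

theorem matPd_sub_const (A : (ι → ℝ) → Matrix m n ℝ) (C : Matrix m n ℝ) (i : ι) :
    matPd i (fun s => A s - C) = matPd i A := by
  ext x k l
  exact congrArg (fun L : (ι → ℝ) →L[ℝ] ℝ => L (Pi.single i 1)) (fderiv_sub_const (C k l))

theorem matPd_smul (hf : DifferentiableAt ℝ f x) (hA : MatDifferentiableAt A x) :
    matPd i (fun s => f s • A s) x = pd i f x • A x + f x • matPd i A x := by
  ext k l
  exact pd_mul hf (hA k l)

theorem matPd_const_smul (c : ℝ) (hA : MatDifferentiableAt A x) :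
    matPd i (fun s => c • A s) x = c • matPd i A x := by
  ext k l
  exact pd_const_mul c (hA k l)

theorem matPd_sum {κ : Type*} {s : Finset κ} {A : κ → (ι → ℝ) → Matrix m n ℝ}
    (hA : ∀ c ∈ s, MatDifferentiableAt (A c) x) :
    matPd i (fun y => ∑ c ∈ s, A c y) x = ∑ c ∈ s, matPd i (A c) x := by
  ext k l
  simp only [matPd, Matrix.of_apply, Matrix.sum_apply]
  exact pd_sum fun c hc => hA c hc k l

theorem matPd_mul [Fintype m] {A : (ι → ℝ) → Matrix l m ℝ} (hA : MatDifferentiableAt A x)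
    (hB : MatDifferentiableAt B x) :
    matPd i (fun s => A s * B s) x = matPd i A x * B x + A x * matPd i B x := by
  ext k l
  simp only [matPd, Matrix.of_apply, Matrix.add_apply, Matrix.mul_apply]
  rw [pd_sum fun c _ => (hA k c).fun_mul (hB c l), ← Finset.sum_add_distrib]
  exact Finset.sum_congr rfl fun c _ => pd_mul (hA k c) (hB c l)

theorem matPd_matPd_mul [Fintype m] {A : (ι → ℝ) → Matrix l m ℝ}
    (hU : IsOpen U) (hA : MatSmoothOn A U) (hB : MatSmoothOn B U) (hx : x ∈ U) (i j : ι) :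
    matPd i (matPd j (fun s => A s * B s)) x
      = matPd i (matPd j A) x * B x + matPd j A x * matPd i B x + matPd i A x * matPd j B x
        + A x * matPd i (matPd j B) x := by
  have hA' {s} (hs : s ∈ U) := hA.matDifferentiableAt hU hs
  have hB' {s} (hs : s ∈ U) := hB.matDifferentiableAt hU hs
  have hdA := (hA.matPd hU j).matDifferentiableAt hU hx
  have hdB := (hB.matPd hU j).matDifferentiableAt hU hx
  rw [matPd_congr_on hU (fun s hs => matPd_mul (hA' hs) (hB' hs)) hx,
    matPd_add (hdA.mul (hB' hx)) ((hA' hx).mul hdB), matPd_mul hdA (hB' hx),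
    matPd_mul (hA' hx) hdB, ← add_assoc]

theorem matPd_comp_mulVec {κ : Type*} [Fintype κ] [DecidableEq κ] (L : Matrix ι κ ℝ) {y : κ → ℝ}
    (hA : MatDifferentiableAt A (L *ᵥ y)) (k : κ) :
    matPd k (fun z => A (L *ᵥ z)) y = ∑ i, L i k • matPd i A (L *ᵥ y) := by
  ext a b
  simpa [Matrix.sum_apply, matPd] using pd_comp_mulVec L (hA a b) k

theorem matPd_comm (hU : IsOpen U) (hA : MatSmoothOn A U) (hx : x ∈ U) :
    matPd i (matPd j A) x = matPd j (matPd i A) x := by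
  ext k l
  exact pd_comm hU (hA k l) hx

theorem isSymm_matPd {A : (ι → ℝ) → Matrix n n ℝ} (hU : IsOpen U)
    (hA : ∀ s ∈ U, (A s).IsSymm) (hx : x ∈ U) : (matPd i A x).IsSymm :=
  matPd_congr_on hU hA hx

theorem pd_trace [Fintype n] {A : (ι → ℝ) → Matrix n n ℝ} (hA : MatDifferentiableAt A x) :
    pd i (fun s => (A s).trace) x = (matPd i A x).trace :=
  pd_sum fun k _ => hA k k

theorem matPd_inv [Fintype n] [DecidableEq n] {A : (ι → ℝ) → Matrix n n ℝ} (hU : IsOpen U)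
    (hA : MatSmoothOn A U) (hdet : ∀ s ∈ U, (A s).det ≠ 0) (hx : x ∈ U) :
    matPd i (fun s => (A s)⁻¹) x = -((A x)⁻¹ * matPd i A x * (A x)⁻¹) := by
  have leibniz : matPd i A x * (A x)⁻¹ + A x * matPd i (fun s => (A s)⁻¹) x = 0 := by
    rw [← matPd_mul (hA.matDifferentiableAt hU hx) ((hA.inv hdet).matDifferentiableAt hU hx),
      matPd_congr_on hU (fun s hs => Matrix.mul_nonsing_inv _ (hdet s hs).isUnit) hx, matPd_const]
  rw [← Matrix.nonsing_inv_mul_cancel_left _ (matPd i (fun s => (A s)⁻¹) x) (hdet x hx).isUnit,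
    eq_neg_of_add_eq_zero_right leibniz, Matrix.mul_neg, Matrix.mul_assoc]

theorem pd_det [Fintype n] [DecidableEq n] {A : (ι → ℝ) → Matrix n n ℝ}
    (hA : MatDifferentiableAt A x) :
    pd i (fun s => (A s).det) x = ((A x).adjugate * matPd i A x).trace := by
  have replaced_column (c : n) :
      ((A x).updateCol c (fun a => matPd i A x a c)).det = ((A x).adjugate * matPd i A x) c c := by
    rw [← Matrix.cramer_apply, Matrix.cramer_eq_adjugate_mulVec]
    rfl
  simp only [Matrix.trace, Matrix.diag_apply, ← replaced_column]
  simp only [Matrix.det_apply', Matrix.updateCol_apply]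
  have hprod (σ : Equiv.Perm n) : DifferentiableAt ℝ (fun s => ∏ a, A s (σ a) a) x :=
    (HasFDerivAt.finsetProd fun a _ => (hA (σ a) a).hasFDerivAt).differentiableAt
  rw [pd_sum fun σ _ => (hprod σ).const_mul _, Finset.sum_comm]
  refine Finset.sum_congr rfl fun σ _ => ?_
  rw [pd_const_mul _ (hprod σ), pd_prod fun a _ => hA _ _,
    Finset.mul_sum]
  refine Finset.sum_congr rfl fun c _ => ?_
  rw [← Finset.prod_erase_mul _ _ (Finset.mem_univ c), if_pos rfl]
  congr 2
  exact Finset.prod_congr rfl fun a ha => (if_neg (Finset.ne_of_mem_erase ha)).symm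

end MatPd

end MatrixCalculus

/-! ### The Ricci tensor in terms of connection matrices -/

section FirstKind

variable {ι : Type*}

/-- The Christoffel symbols of the first kind
`2 Γ_{dec} = ∂_e g_{dc} + ∂_c g_{de} - ∂_d g_{ec}` as a matrix in `d, c`, computed from the
derivatives `P e = ∂_e g`. -/
def firstKind (P : ι → Matrix ι ι ℝ) (e : ι) : Matrix ι ι ℝ :=
  Matrix.of fun d c => P e d c + P c d e - P d e c

theorem matSmoothOn_firstKind {E : Type*} [NormedAddCommGroup E] [NormedSpace ℝ E]
    {P : ι → E → Matrix ι ι ℝ} {M : Set E} (hP : ∀ i, MatSmoothOn (P i) M) (e : ι) :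
    MatSmoothOn (fun s => firstKind (fun i => P i s) e) M :=
  fun d c => ((hP e d c).add (hP c d e)).sub (hP d e c)

theorem firstKind_linear_change [Fintype ι] (P : ι → Matrix ι ι ℝ) (L : Matrix ι ι ℝ) (e : ι) :
    firstKind (fun e => Lᵀ * (∑ i, L i e • P i) * L) e
      = Lᵀ * (∑ i, L i e • firstKind P i) * L := by
  have entry (P : ι → Matrix ι ι ℝ) (e d c : ι) : (Lᵀ * (∑ i, L i e • P i) * L) d c
      = ∑ k, ∑ j, ∑ i, L k c * L j d * L i e * P i j k := by
    simp only [Matrix.mul_apply, Matrix.sum_apply, Matrix.smul_apply, Matrix.transpose_apply,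
      smul_eq_mul]
    simp only [Finset.mul_sum, Finset.sum_mul]
    exact Finset.sum_congr rfl fun k _ => Finset.sum_congr rfl fun j _ =>
      Finset.sum_congr rfl fun i _ => by ring
  ext d c
  simp only [firstKind, Matrix.of_apply, entry, mul_sub, mul_add, Finset.sum_add_distrib,
    Finset.sum_sub_distrib]
  congr 1
  · congr 1
    refine (Finset.sum_comm.trans ((Finset.sum_congr rfl fun _ _ => Finset.sum_comm).trans
      Finset.sum_comm)).trans ?_
    exact Finset.sum_congr rfl fun _ _ => Finset.sum_congr rfl fun _ _ =>
      Finset.sum_congr rfl fun _ _ => by ring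
  · refine (Finset.sum_congr rfl fun _ _ => Finset.sum_comm).trans ?_
    exact Finset.sum_congr rfl fun _ _ => Finset.sum_congr rfl fun _ _ =>
      Finset.sum_congr rfl fun _ _ => by ring

end FirstKind

section Connection

variable {ι : Type*} [Fintype ι] [DecidableEq ι] {g : (ι → ℝ) → Matrix ι ι ℝ} {M : Set (ι → ℝ)}
  {x : ι → ℝ}

/-- The connection matrix `Γ_e = (Γᵃ_{ec})` of `∇_{∂_e}`, as a matrix in `a, c`. -/
def connection (g : (ι → ℝ) → Matrix ι ι ℝ) (e : ι) (x : ι → ℝ) : Matrix ι ι ℝ :=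
  Matrix.of fun a c => christoffel g a e c x

/-- The part `∂_e Γ_b + Γ_e Γ_b` of the curvature endomorphism
`R_{eb} = (∂_e Γ_b + Γ_e Γ_b) - (∂_b Γ_e + Γ_b Γ_e)`. -/
def curvaturePart (g : (ι → ℝ) → Matrix ι ι ℝ) (e b : ι) (x : ι → ℝ) : Matrix ι ι ℝ :=
  matPd e (connection g b) x + connection g e x * connection g b x

/-- The Ricci tensor as a matrix. -/
def ricciMatrix (g : (ι → ℝ) → Matrix ι ι ℝ) (x : ι → ℝ) : Matrix ι ι ℝ :=
  Matrix.of fun b c => ricci g b c x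

theorem connection_eq (g : (ι → ℝ) → Matrix ι ι ℝ) (e : ι) (x : ι → ℝ) :
    connection g e x = (1 / 2 : ℝ) • ((g x)⁻¹ * firstKind (fun i => matPd i g x) e) := by
  ext a c
  simp [connection, christoffel, firstKind, matPd, Matrix.mul_apply]

theorem ricci_eq_curvaturePart (g : (ι → ℝ) → Matrix ι ι ℝ) (b c : ι) (x : ι → ℝ) :
    ricci g b c x = ∑ a, curvaturePart g a b x a c - (curvaturePart g c b x).trace := by
  simp only [ricci, curvaturePart, connection, matPd, Matrix.trace, Matrix.diag_apply,
    Matrix.add_apply, Matrix.of_apply, Matrix.mul_apply, ← Finset.sum_sub_distrib]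
  refine Finset.sum_congr rfl fun a _ => ?_
  rw [Finset.sum_sub_distrib]
  ring

theorem matSmoothOn_connection (hM : IsOpen M) (hg : MatSmoothOn g M)
    (hdet : ∀ s ∈ M, (g s).det ≠ 0) (e : ι) : MatSmoothOn (connection g e) M := by
  rw [funext (connection_eq g e)]
  exact ((hg.inv hdet).mul (matSmoothOn_firstKind (hg.matPd hM) e)).const_smul _

theorem ricciMatrix_congr_on {g' : (ι → ℝ) → Matrix ι ι ℝ} (hM : IsOpen M)
    (h : Set.EqOn g g' M) (hx : x ∈ M) : ricciMatrix g x = ricciMatrix g' x := by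
  have hconn (e : ι) : Set.EqOn (connection g e) (connection g' e) M := fun s hs => by
    simp only [connection_eq, h hs, matPd_congr_on hM h hs]
  ext b c
  simp only [ricciMatrix, Matrix.of_apply, ricci_eq_curvaturePart, curvaturePart,
    fun e => hconn e hx, fun e b => matPd_congr_on (i := e) hM (hconn b) hx]

end Connection

/-! ### Linear changes of coordinates -/

section LinearChange

variable {ι : Type*} [Fintype ι] [DecidableEq ι] {g : (ι → ℝ) → Matrix ι ι ℝ} {M : Set (ι → ℝ)}
  {K L : Matrix ι ι ℝ} {y : ι → ℝ}

/-- The metric `g` in the linear coordinates `y` with `x = L y`. -/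
def linPull (L : Matrix ι ι ℝ) (g : (ι → ℝ) → Matrix ι ι ℝ) (y : ι → ℝ) : Matrix ι ι ℝ :=
  Lᵀ * g (L *ᵥ y) * L

theorem linPull_inv (hLK : L * K = 1) : (linPull L g y)⁻¹ = K * (g (L *ᵥ y))⁻¹ * Kᵀ := by
  rw [linPull, Matrix.mul_inv_rev, Matrix.mul_inv_rev, ← Matrix.transpose_nonsing_inv,
    Matrix.inv_eq_right_inv hLK, Matrix.mul_assoc]

theorem matPd_conj_comp_mulVec {A : (ι → ℝ) → Matrix ι ι ℝ} (C D : Matrix ι ι ℝ)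
    (hA : MatDifferentiableAt A (L *ᵥ y)) (e : ι) :
    matPd e (fun z => C * A (L *ᵥ z) * D) y = C * (∑ i, L i e • matPd i A (L *ᵥ y)) * D := by
  have hC := matDifferentiableAt_const (x := y) C
  rw [matPd_mul (hC.mul (hA.comp_mulVec L)) (matDifferentiableAt_const D),
    matPd_mul hC (hA.comp_mulVec L), matPd_comp_mulVec L hA]
  simp

theorem matPd_linPull (hg : MatDifferentiableAt g (L *ᵥ y)) (e : ι) :
    matPd e (linPull L g) y = Lᵀ * (∑ i, L i e • matPd i g (L *ᵥ y)) * L :=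
  matPd_conj_comp_mulVec Lᵀ L hg e

theorem connection_linPull (hLK : L * K = 1) (hg : MatDifferentiableAt g (L *ᵥ y)) (e : ι) :
    connection (linPull L g) e y = K * (∑ i, L i e • connection g i (L *ᵥ y)) * L := by
  have hKL : Kᵀ * Lᵀ = 1 := by rw [← Matrix.transpose_mul, hLK, Matrix.transpose_one]
  simp only [connection_eq, matPd_linPull hg, firstKind_linear_change, linPull_inv hLK,
    smul_comm _ (1 / 2 : ℝ), ← Finset.smul_sum, ← Matrix.mul_smul, ← Finset.mul_sum]
  simp only [Matrix.mul_smul, Matrix.smul_mul, Matrix.mul_assoc]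
  rw [← Matrix.mul_assoc Kᵀ, hKL, Matrix.one_mul]

theorem curvaturePart_linPull (hLK : L * K = 1) (hM : IsOpen M) (hg : MatSmoothOn g M)
    (hdet : ∀ s ∈ M, (g s).det ≠ 0) (hy : L *ᵥ y ∈ M) (e b : ι) :
    curvaturePart (linPull L g) e b y
      = K * (∑ i, L i e • ∑ j, L j b • curvaturePart g i j (L *ᵥ y)) * L := by
  have hM' : IsOpen ((L *ᵥ ·) ⁻¹' M) :=
    hM.preimage (Matrix.mulVecLin L).toContinuousLinearMap.continuous
  have hconn (b : ι) : Set.EqOn (connection (linPull L g) b)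
      (fun z => K * (∑ j, L j b • connection g j (L *ᵥ z)) * L) ((L *ᵥ ·) ⁻¹' M) := fun z hz =>
    connection_linPull hLK (hg.matDifferentiableAt hM hz) b
  have hdiff (j : ι) : MatDifferentiableAt (connection g j) (L *ᵥ y) :=
    (matSmoothOn_connection hM hg hdet j).matDifferentiableAt hM hy
  have hsum (i : ι) : matPd i (fun s => ∑ j, L j b • connection g j s) (L *ᵥ y)
      = ∑ j, L j b • matPd i (connection g j) (L *ᵥ y) := by
    rw [matPd_sum fun j _ => (hdiff j).const_smul _]
    exact Finset.sum_congr rfl fun j _ => matPd_const_smul _ (hdiff j)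
  have hprod : (K * (∑ i, L i e • connection g i (L *ᵥ y)) * L)
        * (K * (∑ j, L j b • connection g j (L *ᵥ y)) * L)
      = K * (∑ i, L i e • ∑ j, L j b •
          (connection g i (L *ᵥ y) * connection g j (L *ᵥ y))) * L := by
    simp only [Matrix.mul_assoc]
    rw [← Matrix.mul_assoc L K, hLK, Matrix.one_mul, ← Matrix.mul_assoc (∑ i, _) (∑ i, _),
      Finset.sum_mul_sum]
    simp only [Matrix.smul_mul, Matrix.mul_smul, Finset.smul_sum, smul_comm (L _ b)]
  rw [curvaturePart, matPd_congr_on hM' (hconn b) hy, hconn e hy, hconn b hy, hprod,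
    matPd_conj_comp_mulVec K L (.sum fun j _ => .const_smul _ (hdiff j))]
  simp only [hsum, ← Matrix.add_mul, ← Matrix.mul_add, ← Finset.sum_add_distrib, ← smul_add,
    curvaturePart]

theorem sum_diag_mul_sum_smul (hLK : L * K = 1) (X : ι → Matrix ι ι ℝ) (c : ι) :
    ∑ a, (K * ∑ i, L i a • X i) a c = ∑ i, X i i c := by
  have hδ (i a' : ι) : ∑ a, L i a * K a a' = if i = a' then 1 else 0 := by
    rw [← Matrix.mul_apply, hLK, Matrix.one_apply]
  calc ∑ a, (K * ∑ i, L i a • X i) a c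
      = ∑ i, ∑ a', (∑ a, L i a * K a a') * X i a' c := by
        simp only [Matrix.mul_apply, Matrix.sum_apply, Matrix.smul_apply, smul_eq_mul,
          Finset.mul_sum, Finset.sum_mul]
        rw [Finset.sum_congr rfl fun _ _ => Finset.sum_comm, Finset.sum_comm,
          Finset.sum_congr rfl fun _ _ => Finset.sum_comm]
        exact Finset.sum_congr rfl fun _ _ => Finset.sum_congr rfl fun _ _ =>
          Finset.sum_congr rfl fun _ _ => by ring
    _ = ∑ i, X i i c := by simp [hδ]

theorem ricciMatrix_linPull (hLK : L * K = 1) (hM : IsOpen M) (hg : MatSmoothOn g M)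
    (hdet : ∀ s ∈ M, (g s).det ≠ 0) (hy : L *ᵥ y ∈ M) :
    ricciMatrix (linPull L g) y = Lᵀ * ricciMatrix g (L *ᵥ y) * L := by
  have conj (S : Matrix ι ι ℝ) (b c : ι) :
      (Lᵀ * S * L) b c = ∑ j, ∑ k, L j b * S j k * L k c := by
    simp only [Matrix.mul_apply, Matrix.transpose_apply, Finset.sum_mul]
    exact Finset.sum_comm
  ext b c
  simp only [ricciMatrix, conj, Matrix.of_apply, ricci_eq_curvaturePart,
    curvaturePart_linPull hLK hM hg hdet hy, mul_sub, sub_mul, Finset.sum_sub_distrib]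
  congr 1
  · simp only [Matrix.mul_assoc, Finset.sum_mul, Matrix.smul_mul]
    rw [sum_diag_mul_sum_smul hLK]
    simp only [Matrix.sum_apply, Matrix.smul_apply, Matrix.mul_apply, smul_eq_mul, Finset.mul_sum,
      Finset.sum_mul]
    rw [Finset.sum_comm]
    refine Finset.sum_congr rfl fun j _ => ?_
    rw [Finset.sum_comm]
    exact Finset.sum_congr rfl fun k _ => Finset.sum_congr rfl fun a _ => by ring
  · rw [Matrix.mul_assoc, Matrix.trace_mul_comm, Matrix.mul_assoc, hLK, Matrix.mul_one]
    simp only [Matrix.trace_sum, Matrix.trace_smul, smul_eq_mul, Finset.mul_sum]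
    rw [Finset.sum_comm]
    exact Finset.sum_congr rfl fun j _ => Finset.sum_congr rfl fun k _ => by ring

end LinearChange

/-! ### The Ricci tensor as a function of the 2-jet of the metric -/

section Jet

variable {ι : Type*}

theorem firstKind_comm {P : ι → Matrix ι ι ℝ} (hP : ∀ i, (P i).IsSymm) (d e c : ι) :
    firstKind P e d c = firstKind P c d e := by
  simp only [firstKind, Matrix.of_apply, (hP d).apply c e]
  ring

theorem firstKind_add_transpose {P : ι → Matrix ι ι ℝ} (hP : ∀ i, (P i).IsSymm) (e : ι) :
    firstKind P e + (firstKind P e)ᵀ = (2 : ℝ) • P e := by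
  ext d c
  simp only [firstKind, Matrix.add_apply, Matrix.transpose_apply, Matrix.of_apply,
    Matrix.smul_apply, smul_eq_mul, (hP e).apply d c, (hP d).apply e c, (hP c).apply d e]
  ring

variable [Fintype ι]

/-- The Ricci tensor of a metric whose inverse is `G`, whose first derivatives are `P i = ∂_i g`
and whose second derivatives are `Q i j = ∂_i ∂_j g` at the point in question. -/
def jetRicci (G : Matrix ι ι ℝ) (P : ι → Matrix ι ι ℝ) (Q : ι → ι → Matrix ι ι ℝ) (b c : ι) : ℝ :=
  (1 / 2) * ∑ a, ∑ d, G a d * (Q a b d c + Q c d b a - Q a d b c - Q c b d a)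
    + (1 / 4) * ((G * (firstKind P c)ᵀ * G * firstKind P b).trace
      - ∑ a, ∑ d, G a d * ((firstKind P a)ᵀ * G * firstKind P b) d c)

theorem jetRicci_comm {G : Matrix ι ι ℝ} {P : ι → Matrix ι ι ℝ} {Q : ι → ι → Matrix ι ι ℝ}
    (hG : G.IsSymm) (hP : ∀ i, (P i).IsSymm) (hQ : ∀ i j, (Q i j).IsSymm)
    (hQc : ∀ i j, Q i j = Q j i) (b c : ι) : jetRicci G P Q b c = jetRicci G P Q c b := by
  have quadratic : (G * (firstKind P c)ᵀ * G * firstKind P b).trace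
      = (G * (firstKind P b)ᵀ * G * firstKind P c).trace := by
    rw [← Matrix.trace_transpose]
    simp only [Matrix.transpose_mul, Matrix.transpose_transpose, hG.eq]
    rw [← Matrix.mul_assoc, ← Matrix.mul_assoc, Matrix.trace_mul_comm]
    simp only [Matrix.mul_assoc]
  have divergence (d : ι) (X : Matrix ι ι ℝ) :
      (X * firstKind P b) d c = (X * firstKind P c) d b := by
    simp only [Matrix.mul_apply, firstKind_comm hP _ b c]
  simp only [jetRicci, quadratic, divergence]
  congr 2
  rw [Finset.sum_comm]
  refine Finset.sum_congr rfl fun d _ => Finset.sum_congr rfl fun a _ => ?_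
  rw [hG.apply, (hQ a b).apply, (hQ c d).apply, (hQ a d).apply, (hQ c b).apply, hQc a b, hQc c d,
    hQc a d, hQc c b]
  ring

end Jet

section SecondOrder

variable {ι : Type*} [Fintype ι] [DecidableEq ι] {g : (ι → ℝ) → Matrix ι ι ℝ} {M : Set (ι → ℝ)}
  {x : ι → ℝ}

theorem matPd_firstKind (hM : IsOpen M) (hg : MatSmoothOn g M) (hx : x ∈ M) (e b : ι) :
    matPd e (fun s => firstKind (fun i => matPd i g s) b) x
      = firstKind (fun i => matPd e (matPd i g) x) b := by
  have hd (i k l : ι) : DifferentiableAt ℝ (fun s => matPd i g s k l) x :=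
    (hg.matPd hM i).matDifferentiableAt hM hx k l
  ext d c
  exact (pd_sub ((hd b d c).fun_add (hd c d b)) (hd d b c)).trans
    (congrArg (· - _) (pd_add (hd b d c) (hd c d b)))

theorem curvaturePart_eq (hM : IsOpen M) (hg : MatSmoothOn g M) (hsymm : ∀ s ∈ M, (g s).IsSymm)
    (hdet : ∀ s ∈ M, (g s).det ≠ 0) (hx : x ∈ M) (e b : ι) :
    curvaturePart g e b x
      = (1 / 2 : ℝ) • ((g x)⁻¹ * firstKind (fun i => matPd e (matPd i g) x) b)
        - (1 / 4 : ℝ) • ((g x)⁻¹ * ((firstKind (fun i => matPd i g x) e)ᵀ * (g x)⁻¹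
          * firstKind (fun i => matPd i g x) b)) := by
  have hfirst := matSmoothOn_firstKind (hg.matPd hM) b
  have hlower : matPd e g x = (1 / 2 : ℝ) • (firstKind (fun i => matPd i g x) e
      + (firstKind (fun i => matPd i g x) e)ᵀ) := by
    rw [firstKind_add_transpose fun i => isSymm_matPd hM hsymm hx, smul_smul]
    norm_num
  rw [curvaturePart, funext (connection_eq g b), connection_eq g e,
    matPd_const_smul _ (((hg.inv hdet).mul hfirst).matDifferentiableAt hM hx),
    matPd_mul ((hg.inv hdet).matDifferentiableAt hM hx) (hfirst.matDifferentiableAt hM hx),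
    matPd_inv hM hg hdet hx, matPd_firstKind hM hg hx, hlower]
  simp only [Matrix.mul_add, Matrix.add_mul, Matrix.mul_smul, Matrix.smul_mul, Matrix.neg_mul,
    Matrix.mul_assoc, smul_add, smul_neg]
  module

theorem ricci_eq_jetRicci (hM : IsOpen M) (hg : MatSmoothOn g M) (hsymm : ∀ s ∈ M, (g s).IsSymm)
    (hdet : ∀ s ∈ M, (g s).det ≠ 0) (hx : x ∈ M) (b c : ι) :
    ricci g b c x
      = jetRicci (g x)⁻¹ (fun i => matPd i g x) (fun i j => matPd i (matPd j g) x) b c := by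
  have hcomm (i j : ι) : matPd i (matPd j g) x = matPd j (matPd i g) x := matPd_comm hM hg hx
  simp only [ricci_eq_curvaturePart, curvaturePart_eq hM hg hsymm hdet hx, jetRicci,
    Matrix.trace_sub, Matrix.trace_smul, Matrix.sub_apply, Matrix.smul_apply, smul_eq_mul,
    Finset.sum_sub_distrib, ← Finset.mul_sum, ← Matrix.mul_assoc]
  rw [sub_sub_sub_comm, ← mul_sub, ← mul_sub, sub_eq_add_neg, ← mul_neg, neg_sub]
  congr 2
  · simp only [Matrix.trace, Matrix.diag_apply, Matrix.mul_apply, ← Finset.sum_sub_distrib,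
      firstKind, Matrix.of_apply]
    refine Finset.sum_congr rfl fun a _ => Finset.sum_congr rfl fun d _ => ?_
    rw [hcomm a c]
    ring
  · congr 1
    refine Finset.sum_congr rfl fun a _ => ?_
    rw [Matrix.mul_assoc, Matrix.mul_assoc, Matrix.mul_apply]
    simp only [Matrix.mul_assoc]

end SecondOrder

/-! ### The Ricci tensor of a 2-jet with two commuting Killing fields -/

/-- The off-diagonal symmetric matrix with entry `s`. -/
def offDiag (s : ℝ) : Matrix (Fin 2) (Fin 2) ℝ := !![0, s; s, 0]

@[simp] theorem offDiag_zero_zero (s : ℝ) : offDiag s 0 0 = 0 := rfl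
@[simp] theorem offDiag_zero_one (s : ℝ) : offDiag s 0 1 = s := rfl
@[simp] theorem offDiag_one_zero (s : ℝ) : offDiag s 1 0 = s := rfl
@[simp] theorem offDiag_one_one (s : ℝ) : offDiag s 1 1 = 0 := rfl

/-- The 2-jet, at a point where `F = 0`, of a metric with two commuting Killing fields in adapted
coordinates: `q`, `H⁻¹ = K`, the first derivatives of `q`, `H` and of the mixed block `B = F H`, and
their second derivatives. -/
structure KillingJet where
  q : ℝ
  K : Matrix (Fin 2) (Fin 2) ℝ
  dq : Fin 2 → ℝ
  dB : Fin 2 → Matrix (Fin 2) (Fin 2) ℝ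
  dH : Fin 2 → Matrix (Fin 2) (Fin 2) ℝ
  ddq : Fin 2 → Fin 2 → ℝ
  ddB : Fin 2 → Fin 2 → Matrix (Fin 2) (Fin 2) ℝ
  ddH : Fin 2 → Fin 2 → Matrix (Fin 2) (Fin 2) ℝ
  q_ne_zero : q ≠ 0
  K_symm : K.IsSymm
  dH_symm : ∀ i, (dH i).IsSymm
  ddH_symm : ∀ i j, (ddH i j).IsSymm
  ddq_comm : ∀ i j, ddq i j = ddq j i
  ddB_comm : ∀ i j, ddB i j = ddB j i
  ddH_comm : ∀ i j, ddH i j = ddH j i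

namespace KillingJet

variable (Z : KillingJet)

/-- The inverse metric. -/
def invMetric : Matrix (Fin 2 ⊕ Fin 2) (Fin 2 ⊕ Fin 2) ℝ :=
  Matrix.fromBlocks (offDiag (1 / Z.q)) 0 0 Z.K

/-- The first derivatives of the metric. -/
def metricDeriv : Fin 2 ⊕ Fin 2 → Matrix (Fin 2 ⊕ Fin 2) (Fin 2 ⊕ Fin 2) ℝ :=
  Sum.elim (fun i => Matrix.fromBlocks (offDiag (Z.dq i)) (Z.dB i) (Z.dB i)ᵀ (Z.dH i)) 0

/-- The second derivatives of the orbit block `g̃ + B H⁻¹ Bᵀ`; only these two terms survive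
because `B = 0` at the point. -/
def orbitDeriv₂ (i j : Fin 2) : Matrix (Fin 2) (Fin 2) ℝ :=
  offDiag (Z.ddq i j) + (Z.dB i * Z.K * (Z.dB j)ᵀ + Z.dB j * Z.K * (Z.dB i)ᵀ)

/-- The second derivatives of the metric. -/
def metricDeriv₂ :
    Fin 2 ⊕ Fin 2 → Fin 2 ⊕ Fin 2 → Matrix (Fin 2 ⊕ Fin 2) (Fin 2 ⊕ Fin 2) ℝ :=
  Sum.elim (fun i => Sum.elim (fun j =>
    Matrix.fromBlocks (Z.orbitDeriv₂ i j) (Z.ddB i j) (Z.ddB i j)ᵀ (Z.ddH i j)) 0) 0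

/-- The Ricci tensor of the jet. -/
def ricci : Fin 2 ⊕ Fin 2 → Fin 2 ⊕ Fin 2 → ℝ :=
  jetRicci Z.invMetric Z.metricDeriv Z.metricDeriv₂

/-- The twist `(∂₂ F₁ - ∂₁ F₂) H` of the connection `F`, which is `∂₂ B₁ - ∂₁ B₂` where `F = 0`. -/
def twist (k : Fin 2) : ℝ := Z.dB 1 0 k - Z.dB 0 1 k

/-- The derivatives `∂_e ((∂₂ F₁ - ∂₁ F₂) H)`, expressed through the derivatives of `B = F H`. -/
def twistDeriv (e k : Fin 2) : ℝ :=
  Z.ddB e 1 0 k - Z.ddB e 0 1 k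
    - ((Z.dB e * Z.K * Z.dH 1) 0 k - (Z.dB e * Z.K * Z.dH 0) 1 k)

theorem ricci_comm (b c : Fin 2 ⊕ Fin 2) : Z.ricci b c = Z.ricci c b := by
  have offDiag_symm (s : ℝ) : (offDiag s).IsSymm := by
    ext i j; fin_cases i <;> fin_cases j <;> rfl
  have orbit_symm (i j : Fin 2) : (Z.orbitDeriv₂ i j).IsSymm := by
    simp only [Matrix.IsSymm, orbitDeriv₂, Matrix.transpose_add, Matrix.transpose_mul,
      Matrix.transpose_transpose, (offDiag_symm _).eq, Z.K_symm.eq, Matrix.mul_assoc]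
    rw [add_comm (Z.dB j * _)]
  refine jetRicci_comm ?_ ?_ ?_ ?_ b c
  · exact (offDiag_symm _).fromBlocks rfl Z.K_symm
  · rintro (i | i)
    · exact (offDiag_symm _).fromBlocks rfl (Z.dH_symm i)
    · rfl
  · rintro (i | i) (j | j)
    · exact (orbit_symm i j).fromBlocks rfl (Z.ddH_symm i j)
    all_goals rfl
  · rintro (i | i) (j | j)
    · simp only [metricDeriv₂, Sum.elim_inl, orbitDeriv₂, Z.ddq_comm i j, Z.ddB_comm i j,
        Z.ddH_comm i j, add_comm (Z.dB i * Z.K * _)]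
    all_goals rfl

theorem firstKind_inl (i : Fin 2) :
    firstKind Z.metricDeriv (.inl i)
      = Matrix.fromBlocks (Matrix.single (1 - i) i (2 * Z.dq i))
          (Matrix.of fun j l => Z.dB i j l - Z.dB j i l)
          (Matrix.of fun k m => Z.dB i m k + Z.dB m i k) (Z.dH i) := by
  ext (j | j) (m | m)
  · fin_cases i <;> fin_cases j <;> fin_cases m <;> simp [firstKind, metricDeriv, two_mul]
  all_goals simp [firstKind, metricDeriv]

theorem firstKind_inr (n : Fin 2) :
    firstKind Z.metricDeriv (.inr n)
      = Matrix.fromBlocks (Matrix.of fun j m => Z.dB m j n - Z.dB j m n)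
          (Matrix.of fun j l => -Z.dH j n l) (Matrix.of fun k m => Z.dH m k n) 0 := by
  ext (j | j) (m | m) <;> simp [firstKind, metricDeriv]

theorem K_one_zero : Z.K 1 0 = Z.K 0 1 := Z.K_symm.apply 0 1

theorem dH_one_zero (i : Fin 2) : Z.dH i 1 0 = Z.dH i 0 1 := (Z.dH_symm i).apply 0 1

theorem ddH_one_zero (i j : Fin 2) : Z.ddH i j 1 0 = Z.ddH i j 0 1 := (Z.ddH_symm i j).apply 0 1

theorem ricci_inr_inr (k l : Fin 2) :
    Z.ricci (.inr k) (.inr l)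
      = -(1 / (2 * Z.q)) * (2 * Z.ddH 0 1 k l - (Z.dH 0 * Z.K * Z.dH 1) k l
          - (Z.dH 1 * Z.K * Z.dH 0) k l + (Z.K * Z.dH 1).trace / 2 * Z.dH 0 k l
          + (Z.K * Z.dH 0).trace / 2 * Z.dH 1 k l)
        - 1 / (2 * Z.q ^ 2) * (Z.twist k * Z.twist l) := by
  have hq := Z.q_ne_zero
  simp only [ricci, jetRicci, Fintype.sum_sum_type, Fin.sum_univ_two, firstKind_inl, firstKind_inr,
    invMetric, metricDeriv₂, Matrix.trace, Matrix.diag, Matrix.mul_apply, twist,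
    Matrix.transpose_apply]
  fin_cases k <;> fin_cases l <;> simp [Z.dH_one_zero, Z.K_one_zero, Z.ddH_comm 1 0] <;>
    field_simp <;> ring

theorem ricci_inl_inr (e k : Fin 2) :
    Z.ricci (.inl e) (.inr k)
      = ![-1, 1] e / (2 * Z.q)
        * (((Z.K * Z.dH e).trace / 2 - Z.dq e / Z.q) * Z.twist k + Z.twistDeriv e k) := by
  have hq := Z.q_ne_zero
  simp only [ricci, jetRicci, Fintype.sum_sum_type, Fin.sum_univ_two, firstKind_inl, firstKind_inr,
    invMetric, metricDeriv₂, Matrix.trace, Matrix.diag, Matrix.mul_apply, twist, twistDeriv,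
    Matrix.transpose_apply]
  fin_cases k <;> fin_cases e <;> simp [Z.dH_one_zero, Z.K_one_zero, Z.ddB_comm 1 0] <;>
    field_simp <;> ring

theorem ricci_inl_self (e : Fin 2) :
    Z.ricci (.inl e) (.inl e)
      = Z.dq e / Z.q * (Z.K * Z.dH e).trace / 2 - (Z.K * Z.ddH e e).trace / 2
        + (Z.K * Z.dH e * Z.K * Z.dH e).trace / 4 := by
  have hq := Z.q_ne_zero
  simp only [ricci, jetRicci, Fintype.sum_sum_type, Fin.sum_univ_two, firstKind_inl, firstKind_inr,
    invMetric, metricDeriv₂, Matrix.trace, Matrix.diag, Matrix.mul_apply,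
    Matrix.transpose_apply]
  fin_cases e <;> simp [Z.dH_one_zero, Z.K_one_zero, Z.ddH_one_zero] <;> field_simp <;> ring

theorem ricci_inl_zero_inl_one :
    Z.ricci (.inl 0) (.inl 1)
      = -(Z.ddq 0 1 / Z.q - Z.dq 0 * Z.dq 1 / Z.q ^ 2) - (Z.K * Z.ddH 0 1).trace / 2
        + (Z.K * Z.dH 0 * Z.K * Z.dH 1).trace / 4 + (Z.twist ⬝ᵥ Z.K *ᵥ Z.twist) / (2 * Z.q) := by
  have hq := Z.q_ne_zero
  simp only [ricci, jetRicci, Fintype.sum_sum_type, Fin.sum_univ_two, firstKind_inl, firstKind_inr,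
    invMetric, metricDeriv₂, Matrix.trace, Matrix.diag, Matrix.mul_apply, Matrix.transpose_apply,
    orbitDeriv₂, Matrix.mulVec, dotProduct, twist]
  simp [Matrix.mul_apply, Z.dH_one_zero, Z.K_one_zero, Z.ddH_one_zero, Z.ddH_comm 1 0,
    Z.ddq_comm 1 0]
  field_simp
  ring

end KillingJet

/-! ### Functions of the orbit coordinates -/

section OrbitFunctions

variable {m n : Type*} {U : Set (Fin 2 → ℝ)} {x : Fin 2 ⊕ Fin 2 → ℝ}

theorem proj_eq_mulVec :
    proj = fun x => (Matrix.fromCols 1 0 : Matrix (Fin 2) (Fin 2 ⊕ Fin 2) ℝ) *ᵥ x := by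
  ext x i
  simp [proj, Matrix.mulVec, dotProduct, Matrix.one_apply]

theorem contDiff_proj : ContDiff ℝ ∞ proj :=
  contDiff_pi' fun i => contDiff_apply ℝ ℝ (Sum.inl i)

theorem isOpen_preimage_proj (hU : IsOpen U) : IsOpen (proj ⁻¹' U) :=
  hU.preimage contDiff_proj.continuous

theorem matPd_comp_proj {A : (Fin 2 → ℝ) → Matrix m n ℝ} (hA : MatDifferentiableAt A (proj x))
    (e : Fin 2 ⊕ Fin 2) :
    matPd e (fun y => A (proj y)) x = Sum.elim (fun i => matPd i A (proj x)) 0 e := by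
  rw [proj_eq_mulVec] at hA ⊢
  rw [matPd_comp_mulVec _ hA]
  rcases e with i | k
  · simp [Matrix.one_apply]
  · simp

/-- A symmetric block matrix function of the orbit coordinates. -/
def blockPull (A B D : (Fin 2 → ℝ) → Matrix (Fin 2) (Fin 2) ℝ) (x : Fin 2 ⊕ Fin 2 → ℝ) :
    Matrix (Fin 2 ⊕ Fin 2) (Fin 2 ⊕ Fin 2) ℝ :=
  Matrix.fromBlocks (A (proj x)) (B (proj x)) (B (proj x))ᵀ (D (proj x))

variable {A B D : (Fin 2 → ℝ) → Matrix (Fin 2) (Fin 2) ℝ}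

theorem MatSmoothOn.blockPull (hA : MatSmoothOn A U) (hB : MatSmoothOn B U)
    (hD : MatSmoothOn D U) : MatSmoothOn (blockPull A B D) (proj ⁻¹' U) := by
  have comp_proj {f : (Fin 2 → ℝ) → ℝ} (hf : ContDiffOn ℝ ∞ f U) :
      ContDiffOn ℝ ∞ (fun x => f (proj x)) (proj ⁻¹' U) :=
    hf.comp contDiff_proj.contDiffOn fun _ => id
  rintro (a | a) (b | b)
  exacts [comp_proj (hA a b), comp_proj (hB a b), comp_proj (hB b a), comp_proj (hD a b)]

theorem matPd_blockPull (hA : MatDifferentiableAt A (proj x)) (hB : MatDifferentiableAt B (proj x))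
    (hD : MatDifferentiableAt D (proj x)) (e : Fin 2 ⊕ Fin 2) :
    matPd e (blockPull A B D) x
      = Sum.elim (fun i => blockPull (matPd i A) (matPd i B) (matPd i D) x) 0 e := by
  have blocks : matPd e (blockPull A B D) x
      = Matrix.fromBlocks (matPd e (fun y => A (proj y)) x) (matPd e (fun y => B (proj y)) x)
          (matPd e (fun y => B (proj y)) x)ᵀ (matPd e (fun y => D (proj y)) x) := by
    ext (a | a) (b | b) <;> rfl
  rw [blocks, matPd_comp_proj hA, matPd_comp_proj hB, matPd_comp_proj hD]
  rcases e with i | k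
  · rfl
  · simp

theorem matPd_matPd_blockPull (hU : IsOpen U) (hA : MatSmoothOn A U) (hB : MatSmoothOn B U)
    (hD : MatSmoothOn D U) (hx : proj x ∈ U) (e f : Fin 2 ⊕ Fin 2) :
    matPd e (matPd f (blockPull A B D)) x
      = (Sum.elim (fun i => Sum.elim (fun j => blockPull (matPd i (matPd j A))
          (matPd i (matPd j B)) (matPd i (matPd j D)) x) 0) 0 : _ → _ → Matrix _ _ ℝ) e f := by
  rw [matPd_congr_on (isOpen_preimage_proj hU) (fun y hy => matPd_blockPull
    (hA.matDifferentiableAt hU hy) (hB.matDifferentiableAt hU hy)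
    (hD.matDifferentiableAt hU hy) f) hx]
  rcases f with j | j
  · have hd {A : (Fin 2 → ℝ) → Matrix (Fin 2) (Fin 2) ℝ} (hA : MatSmoothOn A U) :
        MatDifferentiableAt (matPd j A) (proj x) := (hA.matPd hU j).matDifferentiableAt hU hx
    exact (matPd_blockPull (hd hA) (hd hB) (hd hD) e).trans (by rcases e with _ | _ <;> rfl)
  · exact (matPd_const 0).trans (by rcases e with _ | _ <;> rfl)

theorem matSmoothOn_nullForm {q : (Fin 2 → ℝ) → ℝ} {U : Set (Fin 2 → ℝ)}
    (hq : ContDiffOn ℝ ∞ q U) : MatSmoothOn (nullForm q) U := by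
  intro i j
  fin_cases i <;> fin_cases j
  exacts [contDiffOn_const, hq, hq, contDiffOn_const]

theorem matPd_nullForm (q : (Fin 2 → ℝ) → ℝ) (i : Fin 2) :
    matPd i (nullForm q) = nullForm (pd i q) := by
  ext t k l
  fin_cases k <;> fin_cases l
  exacts [pd_const 0, rfl, rfl, pd_const 0]

theorem isSymm_nullForm (q : (Fin 2 → ℝ) → ℝ) (t : Fin 2 → ℝ) : (nullForm q t).IsSymm := by
  ext k l
  fin_cases k <;> fin_cases l <;> rfl

theorem det_nullForm_ne_zero {q : (Fin 2 → ℝ) → ℝ} {t : Fin 2 → ℝ} (hq : q t ≠ 0) :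
    (nullForm q t).det ≠ 0 := by
  simp [nullForm, hq]

theorem nullForm_inv {q : (Fin 2 → ℝ) → ℝ} {t : Fin 2 → ℝ} (hq : q t ≠ 0) :
    (nullForm q t)⁻¹ = offDiag (1 / q t) :=
  Matrix.inv_eq_right_inv <| by
    rw [nullForm, offDiag, Matrix.mul_fin_two, Matrix.one_fin_two]
    simp [hq]

end OrbitFunctions

/-! ### Shears -/

section Shear

variable {U : Set (Fin 2 → ℝ)} {gt H F : (Fin 2 → ℝ) → Matrix (Fin 2) (Fin 2) ℝ}
  {x : Fin 2 ⊕ Fin 2 → ℝ}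

/-- The matrix of the shear `(t, z) ↦ (t, z + Cᵀ t)`, which shifts `F` by the constant `C`. -/
def shear (C : Matrix (Fin 2) (Fin 2) ℝ) : Matrix (Fin 2 ⊕ Fin 2) (Fin 2 ⊕ Fin 2) ℝ :=
  Matrix.fromBlocks 1 0 Cᵀ 1

theorem shear_mul_shear_neg (C : Matrix (Fin 2) (Fin 2) ℝ) : shear C * shear (-C) = 1 := by
  simp [shear, Matrix.fromBlocks_multiply, ← Matrix.fromBlocks_one]

theorem proj_shear_mulVec (C : Matrix (Fin 2) (Fin 2) ℝ) (x : Fin 2 ⊕ Fin 2 → ℝ) :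
    proj (shear C *ᵥ x) = proj x := by
  ext i
  simp [proj, shear, Matrix.mulVec, dotProduct, Matrix.one_apply]

theorem metric_eq_linPull_shear (C : Matrix (Fin 2) (Fin 2) ℝ) (hH : (H (proj x)).IsSymm) :
    metric gt H F x = linPull (shear C) (metric gt H (fun s => F s - C)) x := by
  simp only [metric, linPull, proj_shear_mulVec]
  simp only [shear, Matrix.fromBlocks_transpose,
    Matrix.fromBlocks_multiply, Matrix.transpose_one, Matrix.transpose_zero, Matrix.transpose_mul,
    Matrix.transpose_transpose, Matrix.transpose_sub, hH.eq, Matrix.one_mul, Matrix.mul_one,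
    Matrix.zero_mul, Matrix.mul_zero, zero_add]
  congr 1 <;> noncomm_ring

theorem metric_eq_shear (hH : (H (proj x)).IsSymm) :
    metric gt H F x = (shear (F (proj x)))ᵀ
      * Matrix.fromBlocks (gt (proj x)) 0 0 (H (proj x)) * shear (F (proj x)) := by
  rw [metric_eq_linPull_shear (F (proj x)) hH]
  simp [linPull, metric, proj_shear_mulVec]

theorem det_metric (hH : (H (proj x)).IsSymm) :
    (metric gt H F x).det = (gt (proj x)).det * (H (proj x)).det := by
  rw [metric_eq_shear hH]
  simp [Matrix.det_fromBlocks_zero₂₁, shear]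

theorem isSymm_metric (hgt : (gt (proj x)).IsSymm) (hH : (H (proj x)).IsSymm) :
    (metric gt H F x).IsSymm := by
  rw [Matrix.IsSymm, metric_eq_shear hH]
  simp only [Matrix.transpose_mul, Matrix.transpose_transpose, Matrix.mul_assoc,
    (hgt.fromBlocks Matrix.transpose_zero hH).eq]

theorem matSmoothOn_metric (hgt : MatSmoothOn gt U) (hH : MatSmoothOn H U)
    (hF : MatSmoothOn F U) : MatSmoothOn (metric gt H F) (proj ⁻¹' U) :=
  MatSmoothOn.blockPull (hgt.add ((hF.mul hH).mul hF.transpose)) (hF.mul hH) hH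

theorem ricciMatrix_metric_shear (C : Matrix (Fin 2) (Fin 2) ℝ) (hU : IsOpen U)
    (hgt : MatSmoothOn gt U) (hH : MatSmoothOn H U) (hF : MatSmoothOn F U)
    (hsymm : ∀ t ∈ U, (H t).IsSymm) (hgt_det : ∀ t ∈ U, (gt t).det ≠ 0)
    (hdet : ∀ t ∈ U, (H t).det ≠ 0) (hx : proj x ∈ U) :
    ricciMatrix (metric gt H F) x = (shear C)ᵀ
      * ricciMatrix (metric gt H (fun s => F s - C)) (shear C *ᵥ x) * shear C := by
  rw [ricciMatrix_congr_on (isOpen_preimage_proj hU)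
    (fun y hy => metric_eq_linPull_shear C (hsymm _ hy)) hx]
  refine ricciMatrix_linPull (shear_mul_shear_neg C) (isOpen_preimage_proj hU)
    (matSmoothOn_metric hgt hH (hF.sub (matSmoothOn_const C))) (fun y hy => ?_)
    (by rwa [Set.mem_preimage, proj_shear_mulVec])
  rw [det_metric (hsymm _ hy)]
  exact mul_ne_zero (hgt_det _ hy) (hdet _ hy)

end Shear

/-! ### The Gram matrix of the Killing fields -/

/-- The conditions on the Gram matrix `H` of the Killing fields on the orbit space `U`. -/
structure IsKillingGram (U : Set (Fin 2 → ℝ)) (H : (Fin 2 → ℝ) → Matrix (Fin 2) (Fin 2) ℝ) :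
    Prop where
  isOpen : IsOpen U
  smooth : MatSmoothOn H U
  symm : ∀ t ∈ U, (H t).IsSymm
  det_pos : ∀ t ∈ U, 0 < (H t).det

section GramQuantities

variable (H : (Fin 2 → ℝ) → Matrix (Fin 2) (Fin 2) ℝ)

/-- The logarithmic derivative `H⁻¹ H_{,i}` of the Gram matrix. -/
def logDeriv (i : Fin 2) (t : Fin 2 → ℝ) : Matrix (Fin 2) (Fin 2) ℝ := (H t)⁻¹ * matPd i H t

/-- The logarithmic derivative `(ln r)_{,i}`, in the form `tr (H⁻¹ H_{,i}) / 2`. -/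
def radLogDeriv (i : Fin 2) (t : Fin 2 → ℝ) : ℝ := (logDeriv H i t).trace / 2

/-- The trace `tr (H⁻¹ H_{,i} H⁻¹ H_{,j})`. -/
def quadTrace (i j : Fin 2) (t : Fin 2 → ℝ) : ℝ := (logDeriv H i t * logDeriv H j t).trace

/-- The potential `Λ + A H⁻¹ Aᵀ / (4 r²)`, for which `r_{,12} = -q r (Λ + A H⁻¹ Aᵀ / (4 r²))`. -/
def twistPotential (Λ : ℝ) (A : Fin 2 → ℝ) (t : Fin 2 → ℝ) : ℝ :=
  Λ + A ⬝ᵥ ((H t)⁻¹ *ᵥ A) / (4 * (H t).det)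

theorem quadTrace_comm (i j : Fin 2) (t : Fin 2 → ℝ) : quadTrace H i j t = quadTrace H j i t :=
  Matrix.trace_mul_comm _ _

end GramQuantities

theorem dotProduct_mulVec_self_eq_trace {n : Type*} [Fintype n] (K : Matrix n n ℝ) (A : n → ℝ) :
    A ⬝ᵥ (K *ᵥ A) = (K * Matrix.vecMulVec A A).trace := by
  rw [Matrix.mul_vecMulVec, Matrix.trace_vecMulVec, dotProduct_comm]

namespace IsKillingGram

variable {U : Set (Fin 2 → ℝ)} {H : (Fin 2 → ℝ) → Matrix (Fin 2) (Fin 2) ℝ}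
  (G : IsKillingGram U H) {t : Fin 2 → ℝ}
include G

theorem isUnit_det (ht : t ∈ U) : IsUnit (H t).det := (G.det_pos t ht).ne'.isUnit

theorem det_ne_zero (ht : t ∈ U) : (H t).det ≠ 0 := (G.det_pos t ht).ne'

theorem rad_pos (ht : t ∈ U) : 0 < rad H t := Real.sqrt_pos.2 (G.det_pos t ht)

theorem rad_sq (ht : t ∈ U) : rad H t ^ 2 = (H t).det := Real.sq_sqrt (G.det_pos t ht).le

theorem smooth_inv : MatSmoothOn (fun s => (H s)⁻¹) U := G.smooth.inv fun _ => G.det_ne_zero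

theorem smooth_rad : ContDiffOn ℝ ∞ (rad H) U := G.smooth.det.sqrt fun _ => G.det_ne_zero

theorem smooth_logDeriv (i : Fin 2) : MatSmoothOn (logDeriv H i) U :=
  G.smooth_inv.mul (G.smooth.matPd G.isOpen i)

theorem smooth_radLogDeriv (i : Fin 2) : ContDiffOn ℝ ∞ (radLogDeriv H i) U :=
  (G.smooth_logDeriv i).trace.div_const 2

theorem smooth_quadTrace (i j : Fin 2) : ContDiffOn ℝ ∞ (quadTrace H i j) U :=
  ((G.smooth_logDeriv i).mul (G.smooth_logDeriv j)).trace

theorem differentiableAt {f : (Fin 2 → ℝ) → ℝ} (hf : ContDiffOn ℝ ∞ f U) (ht : t ∈ U) :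
    DifferentiableAt ℝ f t :=
  (hf.contDiffAt (G.isOpen.mem_nhds ht)).differentiableAt (by simp)

theorem pd_det (ht : t ∈ U) (i : Fin 2) :
    pd i (fun s => (H s).det) t = (H t).det * (2 * radLogDeriv H i t) := by
  have adjugate_eq : (H t).adjugate = (H t).det • (H t)⁻¹ := by
    rw [Matrix.inv_def, Ring.inverse_eq_inv', smul_inv_smul₀ (G.det_ne_zero ht)]
  rw [G2Metric.pd_det (G.smooth.matDifferentiableAt G.isOpen ht), adjugate_eq, Matrix.smul_mul,
    Matrix.trace_smul, smul_eq_mul, radLogDeriv, mul_div_cancel₀ _ two_ne_zero, logDeriv]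

theorem pd_rad (ht : t ∈ U) (i : Fin 2) : pd i (rad H) t = rad H t * radLogDeriv H i t := by
  have hr := G.rad_pos ht
  unfold rad
  rw [pd_sqrt (G.differentiableAt G.smooth.det ht) (G.det_ne_zero ht), G.pd_det ht,
    ← rad, ← G.rad_sq ht]
  field_simp

theorem pd_log_rad (ht : t ∈ U) (i : Fin 2) :
    pd i (fun s => Real.log (rad H s)) t = radLogDeriv H i t := by
  have hr := (G.rad_pos ht).ne'
  rw [pd_log (G.differentiableAt G.smooth_rad ht) hr, G.pd_rad ht, mul_div_cancel_left₀ _ hr]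

theorem matPd_inv_mul (ht : t ∈ U) {B : (Fin 2 → ℝ) → Matrix (Fin 2) (Fin 2) ℝ}
    (hB : MatDifferentiableAt B t) (j : Fin 2) :
    matPd j (fun s => (H s)⁻¹ * B s) t
      = (H t)⁻¹ * matPd j B t - logDeriv H j t * ((H t)⁻¹ * B t) := by
  rw [matPd_mul (G.smooth_inv.matDifferentiableAt G.isOpen ht) hB,
    matPd_inv G.isOpen G.smooth (fun _ => G.det_ne_zero) ht, logDeriv]
  noncomm_ring

theorem matPd_logDeriv (ht : t ∈ U) (i j : Fin 2) :
    matPd j (logDeriv H i) t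
      = (H t)⁻¹ * matPd j (matPd i H) t - logDeriv H j t * logDeriv H i t :=
  G.matPd_inv_mul ht ((G.smooth.matPd G.isOpen i).matDifferentiableAt G.isOpen ht) j

theorem pd_radLogDeriv_eq_trace (ht : t ∈ U) (i j : Fin 2) :
    pd j (radLogDeriv H i) t = (matPd j (logDeriv H i) t).trace / 2 := by
  have hL := (G.smooth_logDeriv i).matDifferentiableAt G.isOpen ht
  unfold radLogDeriv
  simp only [div_eq_inv_mul]
  rw [pd_const_mul _ (G.differentiableAt (G.smooth_logDeriv i).trace ht), pd_trace hL]

theorem pd_radLogDeriv (ht : t ∈ U) (i j : Fin 2) :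
    pd j (radLogDeriv H i) t
      = (((H t)⁻¹ * matPd j (matPd i H) t).trace - quadTrace H j i t) / 2 := by
  rw [G.pd_radLogDeriv_eq_trace ht, G.matPd_logDeriv ht, Matrix.trace_sub, quadTrace]

theorem pd_radLogDeriv_comm (ht : t ∈ U) (i j : Fin 2) :
    pd j (radLogDeriv H i) t = pd i (radLogDeriv H j) t := by
  rw [G.pd_radLogDeriv ht, G.pd_radLogDeriv ht, quadTrace_comm, matPd_comm G.isOpen G.smooth ht]

theorem pd_quadTrace_self (ht : t ∈ U) (i j : Fin 2) :
    pd j (quadTrace H i i) t = (logDeriv H i t * (2 : ℝ) • matPd j (logDeriv H i) t).trace := by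
  have hL := (G.smooth_logDeriv i).matDifferentiableAt G.isOpen ht
  unfold quadTrace
  rw [pd_trace (hL.mul hL), matPd_mul hL hL, Matrix.trace_add, Matrix.trace_mul_comm (matPd _ _ _),
    Matrix.mul_smul, Matrix.trace_smul, smul_eq_mul, two_mul]

theorem smooth_twistNorm (A : Fin 2 → ℝ) :
    ContDiffOn ℝ ∞ (fun s => A ⬝ᵥ ((H s)⁻¹ *ᵥ A)) U := by
  simp only [dotProduct_mulVec_self_eq_trace]
  exact (G.smooth_inv.mul (matSmoothOn_const _)).trace

theorem smooth_twistPotential (Λ : ℝ) (A : Fin 2 → ℝ) :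
    ContDiffOn ℝ ∞ (twistPotential H Λ A) U :=
  contDiffOn_const.add ((G.smooth_twistNorm A).div (contDiffOn_const.mul G.smooth.det)
    fun _ hs => mul_ne_zero four_ne_zero (G.det_ne_zero hs))

theorem pd_twistNorm (ht : t ∈ U) (A : Fin 2 → ℝ) (j : Fin 2) :
    pd j (fun s => A ⬝ᵥ ((H s)⁻¹ *ᵥ A)) t
      = -(logDeriv H j t * ((H t)⁻¹ * Matrix.vecMulVec A A)).trace := by
  simp only [dotProduct_mulVec_self_eq_trace]
  rw [pd_trace ((G.smooth_inv.mul (matSmoothOn_const _)).matDifferentiableAt G.isOpen ht),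
    G.matPd_inv_mul ht (matDifferentiableAt_const _), matPd_const, Matrix.mul_zero, zero_sub,
    Matrix.trace_neg]

theorem pd_twistPotential (ht : t ∈ U) (Λ : ℝ) (A : Fin 2 → ℝ) (j : Fin 2) :
    pd j (twistPotential H Λ A) t
      = -(logDeriv H j t * ((H t)⁻¹ * Matrix.vecMulVec A A)).trace / (4 * (H t).det)
        - 2 * radLogDeriv H j t * (twistPotential H Λ A t - Λ) := by
  have hdet := G.det_ne_zero ht
  have hdet_diff := G.differentiableAt G.smooth.det ht
  have hnorm := G.smooth_twistNorm A
  have hquot : ContDiffOn ℝ ∞ (fun s => A ⬝ᵥ ((H s)⁻¹ *ᵥ A) / (4 * (H s).det)) U :=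
    hnorm.div (contDiffOn_const.mul G.smooth.det)
      fun _ hs => mul_ne_zero four_ne_zero (G.det_ne_zero hs)
  unfold twistPotential
  rw [pd_add (differentiableAt_const _) (G.differentiableAt hquot ht), pd_const,
    pd_div (G.differentiableAt hnorm ht) (hdet_diff.const_mul 4)
      (mul_ne_zero four_ne_zero hdet), pd_const_mul _ hdet_diff, G.pd_det ht, G.pd_twistNorm ht]
  field_simp
  ring

end IsKillingGram

/-! ### The matrix equation and its trace -/

section Residuals

variable (Λ : ℝ) (H : (Fin 2 → ℝ) → Matrix (Fin 2) (Fin 2) ℝ) (q : (Fin 2 → ℝ) → ℝ)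
  (A : Fin 2 → ℝ) (t : Fin 2 → ℝ)

/-- The residual of the matrix equation, divided by `r` and conjugated by `H`, so that it is
expressed through the logarithmic derivatives `H⁻¹ H_{,i}`. -/
def mixedResidual : Matrix (Fin 2) (Fin 2) ℝ :=
  matPd 1 (logDeriv H 0) t + matPd 0 (logDeriv H 1) t
    + (radLogDeriv H 1 t • logDeriv H 0 t + radLogDeriv H 0 t • logDeriv H 1 t)
    + ((2 * Λ * q t) • (1 : Matrix (Fin 2) (Fin 2) ℝ)
      + (q t / (H t).det) • ((H t)⁻¹ * Matrix.vecMulVec A A))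

/-- The residual `r_{,12} / r + q (Λ + A H⁻¹ Aᵀ / (4 r²))` of the equation for `r`. -/
def radResidual : ℝ :=
  pd 1 (radLogDeriv H 0) t + radLogDeriv H 0 t * radLogDeriv H 1 t + q t * twistPotential H Λ A t

end Residuals

namespace IsKillingGram

variable {U : Set (Fin 2 → ℝ)} {H : (Fin 2 → ℝ) → Matrix (Fin 2) (Fin 2) ℝ}
  (G : IsKillingGram U H) {q : (Fin 2 → ℝ) → ℝ} {t : Fin 2 → ℝ} {Λ : ℝ} {A : Fin 2 → ℝ}
  {i j : Fin 2}
include G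

theorem matPd_flux (ht : t ∈ U) (i j : Fin 2) :
    matPd j (fun s => rad H s • (matPd i H s * (H s)⁻¹)) t
      = rad H t • (H t * (matPd j (logDeriv H i) t + logDeriv H j t * logDeriv H i t
          - logDeriv H i t * logDeriv H j t + radLogDeriv H j t • logDeriv H i t) * (H t)⁻¹) := by
  have hHi := (G.smooth.matPd G.isOpen i).matDifferentiableAt G.isOpen ht
  have hK := G.smooth_inv.matDifferentiableAt G.isOpen ht
  rw [matPd_smul (G.differentiableAt G.smooth_rad ht) (hHi.mul hK), matPd_mul hHi hK, G.pd_rad ht,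
    matPd_inv G.isOpen G.smooth (fun _ => G.det_ne_zero) ht, G.matPd_logDeriv ht, sub_add_cancel]
  simp only [logDeriv, Matrix.mul_add, Matrix.mul_sub, Matrix.mul_smul,
    Matrix.mul_assoc, Matrix.mul_nonsing_inv_cancel_left _ _ (G.isUnit_det ht)]
  simp only [Matrix.add_mul, Matrix.sub_mul, Matrix.smul_mul, Matrix.mul_neg, Matrix.mul_assoc]
  module

theorem matrixResidual_eq (ht : t ∈ U) :
    matrixResidual Λ H q A t = rad H t • (H t * mixedResidual Λ H q A t * (H t)⁻¹) := by
  have hr := (G.rad_pos ht).ne'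
  have twist_coeff : q t / rad H t = rad H t * (q t / (H t).det) := by
    rw [← G.rad_sq ht]
    field_simp
  rw [matrixResidual, G.matPd_flux ht, G.matPd_flux ht, mixedResidual, twist_coeff]
  simp only [Matrix.mul_add, Matrix.mul_sub, Matrix.mul_smul, Matrix.add_mul, Matrix.sub_mul,
    Matrix.smul_mul, Matrix.mul_one, Matrix.mul_nonsing_inv_cancel_left _ _ (G.isUnit_det ht),
    Matrix.mul_nonsing_inv _ (G.isUnit_det ht)]
  module

theorem matrixResidual_eq_zero_iff (ht : t ∈ U) :
    matrixResidual Λ H q A t = 0 ↔ mixedResidual Λ H q A t = 0 := by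
  have hdet := G.isUnit_det ht
  rw [G.matrixResidual_eq ht, smul_eq_zero_iff_right (G.rad_pos ht).ne']
  refine ⟨fun h => ?_, fun h => by rw [h, Matrix.mul_zero, Matrix.zero_mul]⟩
  rw [← Matrix.nonsing_inv_mul_cancel_left (H t) (mixedResidual Λ H q A t) hdet,
    ← Matrix.nonsing_inv_mul_cancel_right (H t) (H t * mixedResidual Λ H q A t) hdet, h,
    Matrix.zero_mul, Matrix.mul_zero]

theorem matrixEq_iff (ht : t ∈ U) : MatrixEq Λ H q A t ↔ mixedResidual Λ H q A t = 0 := by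
  rw [← G.matrixResidual_eq_zero_iff ht, MatrixEq, matrixResidual, ← sub_eq_zero]
  exact Eq.congr (by abel) rfl

theorem trace_mixedResidual (ht : t ∈ U) :
    (mixedResidual Λ H q A t).trace = 4 * radResidual Λ H q A t := by
  have hdet := G.det_ne_zero ht
  have trace_logDeriv (i : Fin 2) : (logDeriv H i t).trace = 2 * radLogDeriv H i t := by
    rw [radLogDeriv, mul_div_cancel₀ _ two_ne_zero]
  have trace_deriv (i j : Fin 2) :
      (matPd j (logDeriv H i) t).trace = 2 * pd j (radLogDeriv H i) t := by
    rw [G.pd_radLogDeriv_eq_trace ht, mul_div_cancel₀ _ two_ne_zero]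
  simp only [mixedResidual, radResidual, twistPotential, Matrix.trace_add, Matrix.trace_smul,
    Matrix.trace_one, trace_logDeriv, trace_deriv, G.pd_radLogDeriv_comm ht 1 0,
    ← dotProduct_mulVec_self_eq_trace, smul_eq_mul, Fintype.card_fin]
  push_cast
  field_simp
  ring

theorem trace_matrixResidual (ht : t ∈ U) :
    (matrixResidual Λ H q A t).trace = 4 * rad H t * radResidual Λ H q A t := by
  rw [G.matrixResidual_eq ht, Matrix.trace_smul, Matrix.trace_mul_comm,
    Matrix.nonsing_inv_mul_cancel_left _ _ (G.isUnit_det ht), G.trace_mixedResidual ht, smul_eq_mul]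
  ring

theorem radResidual_eq_zero (ht : t ∈ U) (h : MatrixEq Λ H q A t) :
    radResidual Λ H q A t = 0 := by
  have htrace := G.trace_mixedResidual (Λ := Λ) (q := q) (A := A) ht
  rw [(G.matrixEq_iff ht).1 h, Matrix.trace_zero] at htrace
  linarith

theorem pd_pd_rad_of_matrixEq (ht : t ∈ U) (h : MatrixEq Λ H q A t) :
    pd 1 (pd 0 (rad H)) t = -Λ * q t * rad H t
      - q t / (4 * rad H t) * (A ⬝ᵥ ((H t)⁻¹ *ᵥ A)) := by
  have hr := (G.rad_pos ht).ne'
  have hres := G.radResidual_eq_zero ht h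
  rw [radResidual, twistPotential, ← G.rad_sq ht] at hres
  rw [pd_congr_on G.isOpen (fun s hs => G.pd_rad hs 0) ht,
    pd_mul (G.differentiableAt G.smooth_rad ht) (G.differentiableAt (G.smooth_radLogDeriv 0) ht),
    G.pd_rad ht]
  linear_combination (norm := (field_simp; ring)) rad H t * hres

theorem mixedResidual_eq (ht : t ∈ U) (hij : i ≠ j) :
    mixedResidual Λ H q A t
      = (2 : ℝ) • matPd j (logDeriv H i) t
        + (logDeriv H j t * logDeriv H i t - logDeriv H i t * logDeriv H j t)
        + (radLogDeriv H j t • logDeriv H i t + radLogDeriv H i t • logDeriv H j t)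
        + ((2 * Λ * q t) • (1 : Matrix (Fin 2) (Fin 2) ℝ)
          + (q t / (H t).det) • ((H t)⁻¹ * Matrix.vecMulVec A A)) := by
  have flatness : matPd i (logDeriv H j) t = matPd j (logDeriv H i) t
      + (logDeriv H j t * logDeriv H i t - logDeriv H i t * logDeriv H j t) := by
    rw [G.matPd_logDeriv ht, G.matPd_logDeriv ht, matPd_comm G.isOpen G.smooth ht]
    abel
  have symmetrized : mixedResidual Λ H q A t = matPd j (logDeriv H i) t + matPd i (logDeriv H j) t
      + (radLogDeriv H j t • logDeriv H i t + radLogDeriv H i t • logDeriv H j t)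
      + ((2 * Λ * q t) • (1 : Matrix (Fin 2) (Fin 2) ℝ)
        + (q t / (H t).det) • ((H t)⁻¹ * Matrix.vecMulVec A A)) := by
    obtain ⟨rfl, rfl⟩ | ⟨rfl, rfl⟩ : i = 0 ∧ j = 1 ∨ i = 1 ∧ j = 0 := by omega
    · rfl
    · rw [mixedResidual, add_comm (matPd 1 _ t), add_comm (radLogDeriv H 1 t • _)]
  rw [symmetrized, flatness, two_smul]
  abel

theorem radResidual_eq (ht : t ∈ U) (hij : i ≠ j) :
    radResidual Λ H q A t = pd j (radLogDeriv H i) t + radLogDeriv H i t * radLogDeriv H j t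
      + q t * twistPotential H Λ A t := by
  obtain ⟨rfl, rfl⟩ | ⟨rfl, rfl⟩ : i = 0 ∧ j = 1 ∨ i = 1 ∧ j = 0 := by omega
  · rfl
  · rw [radResidual, G.pd_radLogDeriv_comm ht, mul_comm (radLogDeriv H 0 t)]

theorem pd_quadTrace_self_of_matrixEq (ht : t ∈ U) (hij : i ≠ j) (h : MatrixEq Λ H q A t) :
    pd j (quadTrace H i i) t
      = -radLogDeriv H j t * quadTrace H i i t - radLogDeriv H i t * quadTrace H i j t
        + 4 * q t * (pd i (twistPotential H Λ A) t
          + radLogDeriv H i t * (2 * twistPotential H Λ A t - 3 * Λ)) := by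
  have hdet := G.det_ne_zero ht
  have hmixed := (G.matrixEq_iff ht).1 h
  rw [G.mixedResidual_eq ht hij, add_assoc, add_assoc, add_eq_zero_iff_eq_neg] at hmixed
  have trace_commutator :
      (logDeriv H i t * (logDeriv H j t * logDeriv H i t)).trace
        = (logDeriv H i t * (logDeriv H i t * logDeriv H j t)).trace := by
    rw [← Matrix.mul_assoc, Matrix.trace_mul_comm]
  have trace_logDeriv : (logDeriv H i t).trace = 2 * radLogDeriv H i t := by
    rw [radLogDeriv, mul_div_cancel₀ _ two_ne_zero]
  rw [G.pd_quadTrace_self ht, hmixed, G.pd_twistPotential ht]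
  simp only [quadTrace, Matrix.mul_neg, Matrix.mul_add, Matrix.mul_sub, Matrix.mul_smul,
    Matrix.mul_one, Matrix.trace_neg, Matrix.trace_add, Matrix.trace_sub, Matrix.trace_smul,
    smul_eq_mul, trace_commutator, trace_logDeriv]
  field_simp
  ring

theorem scalarRhs_eq (ht : t ∈ U) (hρ : radLogDeriv H i t ≠ 0) :
    scalarRhs H i t
      = (pd i (radLogDeriv H i) t + quadTrace H i i t / 4) / radLogDeriv H i t := by
  have trace_eq : (matPd i H t * (H t)⁻¹ * matPd i H t * (H t)⁻¹).trace = quadTrace H i i t := by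
    rw [Matrix.trace_mul_comm, quadTrace, logDeriv]
    simp only [Matrix.mul_assoc]
  rw [scalarRhs, trace_eq, G.pd_log_rad ht,
    pd_congr_on G.isOpen (fun s hs => congrArg Real.log (G.pd_log_rad hs i)) ht,
    pd_log (G.differentiableAt (G.smooth_radLogDeriv i) ht) hρ]
  field_simp

end IsKillingGram

/-! ### Compatibility of the scalar equations -/

/-- The conditions on the Gram matrix `H` and the coefficient `q` of the orbit metric. -/
structure IsOrbitData (U : Set (Fin 2 → ℝ)) (H : (Fin 2 → ℝ) → Matrix (Fin 2) (Fin 2) ℝ)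
    (q : (Fin 2 → ℝ) → ℝ) : Prop extends IsKillingGram U H where
  smooth_q : ContDiffOn ℝ ∞ q U
  q_ne_zero : ∀ t ∈ U, q t ≠ 0

namespace IsOrbitData

variable {U : Set (Fin 2 → ℝ)} {H : (Fin 2 → ℝ) → Matrix (Fin 2) (Fin 2) ℝ} {q : (Fin 2 → ℝ) → ℝ}
  (O : IsOrbitData U H q) {t : Fin 2 → ℝ} {Λ : ℝ} {A : Fin 2 → ℝ} {i j : Fin 2}
include O

theorem radLogDeriv_ne_zero (ht : t ∈ U) (hC : cRho (nullForm q) H t ≠ 0) (i : Fin 2) :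
    radLogDeriv H i t ≠ 0 := by
  contrapose! hC
  have hdet : pd i (fun s => (H s).det) t = 0 := by rw [O.pd_det ht, hC, mul_zero, mul_zero]
  rw [cRho, nullForm_inv (O.q_ne_zero t ht), offDiag]
  fin_cases i <;> simp_all

theorem smooth_matrixResidual (Λ : ℝ) (A : Fin 2 → ℝ) : MatSmoothOn (matrixResidual Λ H q A) U := by
  have flux (i : Fin 2) : MatSmoothOn (fun s => rad H s • (matPd i H s * (H s)⁻¹)) U :=
    .smul O.smooth_rad ((O.smooth.matPd O.isOpen i).mul O.smooth_inv)
  have lambda_coeff : ContDiffOn ℝ ∞ (fun s => 2 * Λ * q s * rad H s) U :=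
    (contDiffOn_const.mul O.smooth_q).mul O.smooth_rad
  have twist_coeff : ContDiffOn ℝ ∞ (fun s => q s / rad H s) U :=
    O.smooth_q.div O.smooth_rad fun s hs => (O.rad_pos hs).ne'
  exact ((((flux 0).matPd O.isOpen 1).add ((flux 1).matPd O.isOpen 0)).add
    (.smul lambda_coeff (matSmoothOn_const 1))).add
    (.smul twist_coeff ((matSmoothOn_const _).mul O.smooth_inv))

theorem smooth_radResidual (Λ : ℝ) (A : Fin 2 → ℝ) :
    ContDiffOn ℝ ∞ (radResidual Λ H q A) U :=
  ((contDiffOn_pd O.isOpen (O.smooth_radLogDeriv 0) 1).add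
    ((O.smooth_radLogDeriv 0).mul (O.smooth_radLogDeriv 1))).add
    (O.smooth_q.mul (O.smooth_twistPotential Λ A))

theorem pd_radResidual (ht : t ∈ U) (hij : i ≠ j) :
    pd i (radResidual Λ H q A) t = pd i (pd j (radLogDeriv H i)) t
      + (pd i (radLogDeriv H i) t * radLogDeriv H j t
        + radLogDeriv H i t * pd i (radLogDeriv H j) t)
      + (pd i q t * twistPotential H Λ A t + q t * pd i (twistPotential H Λ A) t) := by
  have hρ (k : Fin 2) := O.differentiableAt (O.smooth_radLogDeriv k) ht
  have hdρ := O.differentiableAt (contDiffOn_pd O.isOpen (O.smooth_radLogDeriv i) j) ht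
  have hq := O.differentiableAt O.smooth_q ht
  have hV := O.differentiableAt (O.smooth_twistPotential Λ A) ht
  rw [pd_congr_on O.isOpen (fun s hs => O.radResidual_eq hs hij) ht,
    pd_add (hdρ.fun_add ((hρ i).fun_mul (hρ j))) (hq.fun_mul hV),
    pd_add hdρ ((hρ i).fun_mul (hρ j)), pd_mul (hρ i) (hρ j), pd_mul hq hV]

theorem pd_radResidual_eq_zero (ht : t ∈ U) (h : MatrixEq Λ H q A t)
    (hd : matPd i (matrixResidual Λ H q A) t = 0) : pd i (radResidual Λ H q A) t = 0 := by
  have hr := (O.rad_pos ht).ne'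
  have htrace := pd_trace (i := i) ((O.smooth_matrixResidual Λ A).matDifferentiableAt O.isOpen ht)
  rw [hd, Matrix.trace_zero, pd_congr_on O.isOpen (fun s hs => O.trace_matrixResidual hs) ht,
    pd_mul ((O.differentiableAt O.smooth_rad ht).const_mul 4)
      (O.differentiableAt (O.smooth_radResidual Λ A) ht),
    O.radResidual_eq_zero ht h, mul_zero, zero_add] at htrace
  simpa [hr] using htrace

theorem pd_log_q (ht : t ∈ U) (i : Fin 2) :
    pd i (fun s => Real.log (q s)) t = pd i q t / q t :=
  pd_log (O.differentiableAt O.smooth_q ht) (O.q_ne_zero t ht)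

theorem pd_pd_log_q (ht : t ∈ U) (i j : Fin 2) :
    pd j (pd i (fun s => Real.log (q s))) t
      = pd j (pd i q) t / q t - pd i q t * pd j q t / q t ^ 2 := by
  have hq := O.q_ne_zero t ht
  rw [pd_congr_on O.isOpen (fun s hs => O.pd_log_q hs i) ht,
    pd_div (O.differentiableAt (contDiffOn_pd O.isOpen O.smooth_q i) ht)
      (O.differentiableAt O.smooth_q ht) hq]
  field_simp

theorem pd_scalarRhs (ht : t ∈ U) (hij : i ≠ j) (hρ : ∀ s ∈ U, radLogDeriv H i s ≠ 0)
    (h : MatrixEq Λ H q A t) (hd : matPd i (matrixResidual Λ H q A) t = 0)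
    (hs : ScalarEq H q i t) :
    pd j (scalarRhs H i) t = -pd j (radLogDeriv H i) t - quadTrace H i j t / 4
      + q t * (2 * twistPotential H Λ A t - 3 * Λ) := by
  have hρt := hρ t ht
  have hq := O.q_ne_zero t ht
  have hρ_diff := O.differentiableAt (O.smooth_radLogDeriv i) ht
  have hdρ := O.differentiableAt (contDiffOn_pd O.isOpen (O.smooth_radLogDeriv i) i) ht
  have hu := O.differentiableAt (O.smooth_quadTrace i i) ht
  rw [ScalarEq, O.scalarRhs_eq ht hρt, O.pd_log_q ht] at hs
  have hres := O.radResidual_eq_zero ht h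
  have hdres := O.pd_radResidual_eq_zero ht h hd
  rw [O.radResidual_eq ht hij] at hres
  rw [O.pd_radResidual ht hij, O.pd_radLogDeriv_comm ht j i] at hdres
  rw [pd_congr_on O.isOpen (fun s hs => O.scalarRhs_eq hs (hρ s hs)) ht]
  simp only [div_eq_inv_mul _ (4 : ℝ)]
  rw [pd_div (hdρ.fun_add (hu.const_mul _)) hρ_diff hρt, pd_add hdρ (hu.const_mul _),
    pd_const_mul _ hu, O.pd_quadTrace_self_of_matrixEq ht hij h,
    pd_comm O.isOpen (O.smooth_radLogDeriv i) ht]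
  have hs' : pd i q t
      - q t * ((pd i (radLogDeriv H i) t + quadTrace H i i t / 4) / radLogDeriv H i t) = 0 := by
    rw [← hs, mul_div_cancel₀ _ hq, sub_self]
  linear_combination (norm := (field_simp; ring)) (1 / radLogDeriv H i t) * hdres
    - ((pd i (radLogDeriv H i) t + quadTrace H i i t / 4) / radLogDeriv H i t ^ 2) * hres
    - (twistPotential H Λ A t / radLogDeriv H i t) * hs'

theorem compatibleAt (ht : t ∈ U) (hρ : ∀ i, ∀ s ∈ U, radLogDeriv H i s ≠ 0) :
    CompatibleAt Λ H q A t := by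
  intro h hd h₀ h₁
  rw [O.pd_scalarRhs ht zero_ne_one (hρ 0) h (hd 0) h₀,
    O.pd_scalarRhs ht one_ne_zero (hρ 1) h (hd 1) h₁, quadTrace_comm, O.pd_radLogDeriv_comm ht]

end IsOrbitData

/-! ### The Einstein equations at a point -/

/-- The conditions on the functions `H`, `q`, `F` which define a metric with two commuting Killing
fields. -/
structure IsKillingData (U : Set (Fin 2 → ℝ)) (H : (Fin 2 → ℝ) → Matrix (Fin 2) (Fin 2) ℝ)
    (q : (Fin 2 → ℝ) → ℝ) (F : (Fin 2 → ℝ) → Matrix (Fin 2) (Fin 2) ℝ) : Prop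
    extends IsOrbitData U H q where
  smooth_F : MatSmoothOn F U

namespace IsKillingData

variable {U : Set (Fin 2 → ℝ)} {H F : (Fin 2 → ℝ) → Matrix (Fin 2) (Fin 2) ℝ}
  {q : (Fin 2 → ℝ) → ℝ} (D : IsKillingData U H q F) {t : Fin 2 → ℝ} {x : Fin 2 ⊕ Fin 2 → ℝ}
include D

/-- The 2-jet of the metric over `t`, after the shear which makes `F` vanish at `t`. -/
def jet (ht : t ∈ U) : KillingJet where
  q := q t
  K := (H t)⁻¹
  dq i := pd i q t
  dB i := matPd i F t * H t
  dH i := matPd i H t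
  ddq i j := pd i (pd j q) t
  ddB i j := matPd i (matPd j F) t * H t + matPd j F t * matPd i H t + matPd i F t * matPd j H t
  ddH i j := matPd i (matPd j H) t
  q_ne_zero := D.q_ne_zero t ht
  K_symm := (D.symm t ht).inv
  dH_symm i := isSymm_matPd D.isOpen D.symm ht
  ddH_symm i j := isSymm_matPd D.isOpen (fun _ hs => isSymm_matPd D.isOpen D.symm hs) ht
  ddq_comm i j := pd_comm D.isOpen D.smooth_q ht
  ddB_comm i j := by rw [matPd_comm D.isOpen D.smooth_F ht, add_right_comm]
  ddH_comm i j := matPd_comm D.isOpen D.smooth ht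

theorem sub_const (C : Matrix (Fin 2) (Fin 2) ℝ) : IsKillingData U H q (fun s => F s - C) where
  toIsOrbitData := D.toIsOrbitData
  smooth_F := D.smooth_F.sub (matSmoothOn_const C)

theorem smooth_metric : MatSmoothOn (metric (nullForm q) H F) (proj ⁻¹' U) :=
  matSmoothOn_metric (matSmoothOn_nullForm D.smooth_q) D.smooth D.smooth_F

theorem det_metric_ne_zero (hx : proj x ∈ U) : (metric (nullForm q) H F x).det ≠ 0 := by
  rw [det_metric (D.symm _ hx)]
  exact mul_ne_zero (det_nullForm_ne_zero (D.q_ne_zero _ hx)) (D.det_ne_zero hx)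

theorem metric_inv_sheared (ht : t ∈ U) (hx : proj x = t) :
    (metric (nullForm q) H (fun s => F s - F t) x)⁻¹ = (D.jet ht).invMetric := by
  have block_diagonal : metric (nullForm q) H (fun s => F s - F t) x
      = Matrix.fromBlocks (nullForm q t) 0 0 (H t) := by simp [metric, hx]
  rw [block_diagonal, KillingJet.invMetric]
  refine Matrix.inv_eq_right_inv ?_
  simp only [jet, ← nullForm_inv (D.q_ne_zero t ht), Matrix.fromBlocks_multiply,
    Matrix.mul_nonsing_inv _ (det_nullForm_ne_zero (D.q_ne_zero t ht)).isUnit,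
    Matrix.mul_nonsing_inv _ (D.isUnit_det ht), Matrix.mul_zero, Matrix.zero_mul, add_zero,
    zero_add, Matrix.fromBlocks_one]

theorem matPd_mixedBlock (ht : t ∈ U) (i : Fin 2) :
    matPd i (fun s => (F s - F t) * H s) t = (D.jet ht).dB i := by
  rw [matPd_mul ((D.sub_const (F t)).smooth_F.matDifferentiableAt D.isOpen ht)
    (D.smooth.matDifferentiableAt D.isOpen ht), sub_self, Matrix.zero_mul, add_zero,
    matPd_sub_const, jet]

theorem matPd_matPd_mixedBlock (ht : t ∈ U) (i j : Fin 2) :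
    matPd i (matPd j (fun s => (F s - F t) * H s)) t = (D.jet ht).ddB i j := by
  rw [matPd_matPd_mul D.isOpen (D.sub_const (F t)).smooth_F D.smooth ht, sub_self,
    Matrix.zero_mul, add_zero]
  simp only [matPd_sub_const, jet]

theorem matPd_orbitBlock (ht : t ∈ U) (i : Fin 2) :
    matPd i (fun s => nullForm q s + (F s - F t) * H s * (F s - F t)ᵀ) t
      = offDiag (pd i q t) := by
  have hF := (D.sub_const (F t)).smooth_F.matDifferentiableAt D.isOpen ht
  have hFH := hF.mul (D.smooth.matDifferentiableAt D.isOpen ht)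
  rw [matPd_add ((matSmoothOn_nullForm D.smooth_q).matDifferentiableAt D.isOpen ht)
    (hFH.mul hF.transpose), matPd_mul hFH hF.transpose, sub_self, Matrix.transpose_zero,
    Matrix.zero_mul, Matrix.mul_zero, Matrix.zero_mul, add_zero, add_zero, matPd_nullForm]
  rfl

theorem matPd_matPd_orbitBlock (ht : t ∈ U) (i j : Fin 2) :
    matPd i (matPd j (fun s => nullForm q s + (F s - F t) * H s * (F s - F t)ᵀ)) t
      = (D.jet ht).orbitDeriv₂ i j := by
  have hq := matSmoothOn_nullForm D.smooth_q
  have hF := (D.sub_const (F t)).smooth_F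
  have hFH := hF.mul D.smooth
  have deriv_transpose (i : Fin 2) :
      matPd i (fun s => (F s - F t)ᵀ) t = (D.jet ht).K * ((D.jet ht).dB i)ᵀ := by
    rw [matPd_transpose, matPd_sub_const]
    simp only [jet, Matrix.transpose_mul, (D.symm _ ht).eq,
      Matrix.nonsing_inv_mul_cancel_left _ _ (D.isUnit_det ht)]
  rw [matPd_congr_on D.isOpen (fun s hs => matPd_add (hq.matDifferentiableAt D.isOpen hs)
      ((hFH.mul hF.transpose).matDifferentiableAt D.isOpen hs)) ht,
    matPd_add ((hq.matPd D.isOpen j).matDifferentiableAt D.isOpen ht)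
      (((hFH.mul hF.transpose).matPd D.isOpen j).matDifferentiableAt D.isOpen ht),
    matPd_matPd_mul D.isOpen hFH hF.transpose ht, sub_self, Matrix.transpose_zero,
    Matrix.zero_mul, Matrix.mul_zero, Matrix.zero_mul, add_zero, zero_add, matPd_nullForm,
    matPd_nullForm, deriv_transpose, deriv_transpose, D.matPd_mixedBlock ht,
    D.matPd_mixedBlock ht, ← Matrix.mul_assoc, ← Matrix.mul_assoc,
    add_comm ((D.jet ht).dB j * _ * _)]
  rfl

theorem matPd_metric_sheared (ht : t ∈ U) (hx : proj x = t) (e : Fin 2 ⊕ Fin 2) :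
    matPd e (metric (nullForm q) H (fun s => F s - F t)) x = (D.jet ht).metricDeriv e := by
  subst hx
  have hq := (matSmoothOn_nullForm D.smooth_q).matDifferentiableAt D.isOpen ht
  have hH := D.smooth.matDifferentiableAt D.isOpen ht
  have hF := (D.sub_const (F (proj x))).smooth_F.matDifferentiableAt D.isOpen ht
  refine (matPd_blockPull (hq.add ((hF.mul hH).mul hF.transpose)) (hF.mul hH) hH e).trans ?_
  rcases e with i | k
  · simp only [Sum.elim_inl, blockPull, D.matPd_orbitBlock ht, D.matPd_mixedBlock ht]
    rfl
  · rfl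

theorem matPd_matPd_metric_sheared (ht : t ∈ U) (hx : proj x = t) (e f : Fin 2 ⊕ Fin 2) :
    matPd e (matPd f (metric (nullForm q) H (fun s => F s - F t))) x
      = (D.jet ht).metricDeriv₂ e f := by
  subst hx
  have hF := (D.sub_const (F (proj x))).smooth_F
  have hFH := hF.mul D.smooth
  have horbit := (matSmoothOn_nullForm D.smooth_q).add (hFH.mul hF.transpose)
  refine (matPd_matPd_blockPull D.isOpen horbit hFH D.smooth ht e f).trans ?_
  rcases e with i | i
  · rcases f with j | j
    · simp only [Sum.elim_inl, blockPull, D.matPd_matPd_orbitBlock ht,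
        D.matPd_matPd_mixedBlock ht]
      rfl
    · rfl
  · rfl

theorem ricci_metric_sheared (ht : t ∈ U) (hx : proj x = t) (b c : Fin 2 ⊕ Fin 2) :
    ricci (metric (nullForm q) H (fun s => F s - F t)) b c x = (D.jet ht).ricci b c := by
  have D' := D.sub_const (F t)
  have hxU : proj x ∈ U := hx ▸ ht
  rw [ricci_eq_jetRicci (isOpen_preimage_proj D.isOpen) D'.smooth_metric
    (fun y hy => isSymm_metric (isSymm_nullForm q _) (D.symm _ hy))
    (fun y hy => D'.det_metric_ne_zero hy) hxU, KillingJet.ricci, D.metric_inv_sheared ht hx]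
  simp only [D.matPd_metric_sheared ht hx, D.matPd_matPd_metric_sheared ht hx]

theorem ricci_eq_smul_metric_iff (Λ : ℝ) (ht : t ∈ U) (hx : proj x = t) :
    (∀ μ ν, ricci (metric (nullForm q) H F) μ ν x - Λ * metric (nullForm q) H F x μ ν = 0)
      ↔ ∀ μ ν, (D.jet ht).ricci μ ν
          = Λ * Matrix.fromBlocks (nullForm q t) 0 0 (H t) μ ν := by
  subst hx
  set S := shear (F (proj x))
  set R : Matrix (Fin 2 ⊕ Fin 2) (Fin 2 ⊕ Fin 2) ℝ := Matrix.of (D.jet ht).ricci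
  set g₀ := Matrix.fromBlocks (nullForm q (proj x)) 0 0 (H (proj x))
  have ricci_conj : ricciMatrix (metric (nullForm q) H F) x = Sᵀ * R * S := by
    rw [ricciMatrix_metric_shear (F (proj x)) D.isOpen (matSmoothOn_nullForm D.smooth_q) D.smooth
      D.smooth_F D.symm (fun s hs => det_nullForm_ne_zero (D.q_ne_zero s hs))
      (fun s => D.det_ne_zero) ht]
    congr 2
    ext μ ν
    exact D.ricci_metric_sheared ht (proj_shear_mulVec _ x) μ ν
  have metric_conj : metric (nullForm q) H F x = Sᵀ * g₀ * S := metric_eq_shear (D.symm _ ht)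
  have hS : IsUnit S := IsUnit.of_mul_eq_one _ (shear_mul_shear_neg _)
  have unconj (X : Matrix (Fin 2 ⊕ Fin 2) (Fin 2 ⊕ Fin 2) ℝ) : Sᵀ * X * S = 0 ↔ X = 0 := by
    rw [hS.mul_left_eq_zero, (S.isUnit_transpose.2 hS).mul_right_eq_zero]
  calc _ ↔ ricciMatrix (metric (nullForm q) H F) x - Λ • metric (nullForm q) H F x = 0 := by
        rw [← Matrix.ext_iff]
        rfl
    _ ↔ R - Λ • g₀ = 0 := by
        rw [ricci_conj, metric_conj, ← unconj (R - Λ • g₀), Matrix.mul_sub, Matrix.sub_mul,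
          Matrix.mul_smul, Matrix.smul_mul]
    _ ↔ _ := by
        rw [sub_eq_zero, ← Matrix.ext_iff]
        rfl

end IsKillingData

/-! ### The Einstein equations and the reduced system -/

section Twist

variable (H F : (Fin 2 → ℝ) → Matrix (Fin 2) (Fin 2) ℝ) (q : (Fin 2 → ℝ) → ℝ) (t : Fin 2 → ℝ)

/-- The twist `(F_{1,2} - F_{2,1}) H` of the Killing fields. -/
def loweredTwist : Fin 2 → ℝ :=
  (fun k => pd 1 (fun s => F s 0 k) t - pd 0 (fun s => F s 1 k) t) ᵥ* H t

/-- The density `(r / q) (F_{1,2} - F_{2,1}) H`, whose constant value is the vector `A`. -/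
def twistDensity : Fin 2 → ℝ := (rad H t / q t) • loweredTwist H F t

theorem loweredTwist_apply (k : Fin 2) :
    loweredTwist H F t k = (matPd 1 F t * H t) 0 k - (matPd 0 F t * H t) 1 k := by
  simp only [loweredTwist, Matrix.vecMul, dotProduct, Matrix.mul_apply, sub_mul,
    Finset.sum_sub_distrib]
  rfl

end Twist

namespace IsKillingData

variable {U : Set (Fin 2 → ℝ)} {H F : (Fin 2 → ℝ) → Matrix (Fin 2) (Fin 2) ℝ}
  {q : (Fin 2 → ℝ) → ℝ} (D : IsKillingData U H q F) {t : Fin 2 → ℝ} {Λ : ℝ} {A : Fin 2 → ℝ}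
include D

theorem smooth_loweredTwist (k : Fin 2) : ContDiffOn ℝ ∞ (fun s => loweredTwist H F s k) U := by
  simp only [loweredTwist_apply]
  exact ((D.smooth_F.matPd D.isOpen 1).mul D.smooth 0 k).sub
    ((D.smooth_F.matPd D.isOpen 0).mul D.smooth 1 k)

theorem smooth_twistDensity (k : Fin 2) : ContDiffOn ℝ ∞ (fun s => twistDensity H F q s k) U :=
  (D.smooth_rad.div D.smooth_q D.q_ne_zero).mul (D.smooth_loweredTwist k)

theorem jet_twist (ht : t ∈ U) (k : Fin 2) : (D.jet ht).twist k = loweredTwist H F t k :=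
  (loweredTwist_apply H F t k).symm

theorem jet_twistDeriv (ht : t ∈ U) (e k : Fin 2) :
    (D.jet ht).twistDeriv e k = pd e (fun s => loweredTwist H F s k) t := by
  have product (i j : Fin 2) : pd e (fun s => (matPd i F s * H s) j k) t
      = (matPd e (matPd i F) t * H t + matPd i F t * matPd e H t) j k :=
    congrFun₂ (matPd_mul ((D.smooth_F.matPd D.isOpen i).matDifferentiableAt D.isOpen ht)
      (D.smooth.matDifferentiableAt D.isOpen ht)) j k
  have smooth_product (i j : Fin 2) := D.differentiableAt
    ((D.smooth_F.matPd D.isOpen i).mul D.smooth j k) ht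
  simp only [loweredTwist_apply]
  rw [pd_sub (smooth_product 1 0) (smooth_product 0 1), product, product]
  simp only [KillingJet.twistDeriv, jet, Matrix.mul_nonsing_inv_cancel_right _ _ (D.isUnit_det ht),
    Matrix.add_apply]
  ring

theorem pd_twistDensity (ht : t ∈ U) (e k : Fin 2) :
    pd e (fun s => twistDensity H F q s k) t = rad H t / q t
      * ((radLogDeriv H e t - pd e q t / q t) * loweredTwist H F t k
        + pd e (fun s => loweredTwist H F s k) t) := by
  have hr := D.differentiableAt D.smooth_rad ht
  have hq := D.differentiableAt D.smooth_q ht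
  have hdiv : DifferentiableAt ℝ (fun s => rad H s / q s) t :=
    D.differentiableAt (D.smooth_rad.div D.smooth_q D.q_ne_zero) ht
  have hq₀ := D.q_ne_zero t ht
  simp only [twistDensity, Pi.smul_apply, smul_eq_mul]
  rw [pd_mul hdiv (D.differentiableAt (D.smooth_loweredTwist k) ht),
    pd_div hr hq hq₀, D.pd_rad ht]
  field_simp

theorem ricci_inl_inr_eq_zero_iff (ht : t ∈ U) (e k : Fin 2) :
    (D.jet ht).ricci (.inl e) (.inr k) = 0 ↔ pd e (fun s => twistDensity H F q s k) t = 0 := by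
  have hr := (D.rad_pos ht).ne'
  have hq := D.q_ne_zero t ht
  have jet_q : (D.jet ht).q = q t := rfl
  have sign_ne_zero : ![(-1 : ℝ), 1] e ≠ 0 := by fin_cases e <;> simp
  rw [KillingJet.ricci_inl_inr, D.pd_twistDensity ht, D.jet_twist, D.jet_twistDeriv,
    mul_eq_zero_iff_left (div_ne_zero sign_ne_zero (mul_ne_zero two_ne_zero (jet_q ▸ hq))),
    mul_eq_zero_iff_left (div_ne_zero hr hq)]
  rfl

theorem loweredTwist_eq_iff (ht : t ∈ U) :
    loweredTwist H F t = (q t / rad H t) • A ↔ twistDensity H F q t = A := by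
  have hr := (D.rad_pos ht).ne'
  have hq := D.q_ne_zero t ht
  rw [twistDensity, ← inv_div (rad H t), eq_inv_smul_iff₀ (div_ne_zero hr hq)]

theorem twistEq_iff (ht : t ∈ U) : TwistEq H F q A t ↔ twistDensity H F q t = A := by
  have hH := D.isUnit_det ht
  rw [← D.loweredTwist_eq_iff ht, TwistEq, loweredTwist]
  constructor <;> intro h
  · rw [h, Matrix.smul_vecMul, Matrix.vecMul_vecMul, Matrix.nonsing_inv_mul _ hH,
      Matrix.vecMul_one]
  · rw [← Matrix.smul_vecMul, ← h, Matrix.vecMul_vecMul, Matrix.mul_nonsing_inv _ hH,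
      Matrix.vecMul_one]

theorem jet_twist_of_twistEq (ht : t ∈ U) (h : TwistEq H F q A t) :
    (D.jet ht).twist = (q t / rad H t) • A := by
  rw [← (D.loweredTwist_eq_iff ht).2 ((D.twistEq_iff ht).1 h)]
  exact funext (D.jet_twist ht)

theorem exists_twistEq_iff (hUc : IsPreconnected U) :
    (∃ A, ∀ t ∈ U, TwistEq H F q A t)
      ↔ ∀ t (ht : t ∈ U) (e k : Fin 2), (D.jet ht).ricci (.inl e) (.inr k) = 0 := by
  simp only [D.ricci_inl_inr_eq_zero_iff]
  constructor
  · rintro ⟨A, hA⟩ t ht e k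
    rw [pd_congr_on D.isOpen
      (fun s hs => congrFun ((D.twistEq_iff hs).1 (hA s hs)) k) ht, pd_const]
  · intro h
    have constant (k : Fin 2) : ∃ a, ∀ t ∈ U, twistDensity H F q t k = a := by
      refine D.isOpen.exists_is_const_of_fderiv_eq_zero hUc
        ((D.smooth_twistDensity k).differentiableOn (by simp)) fun t ht => ?_
      ext v
      simp [fderiv_eq_sum_pd, h t ht]
    choose A hA using constant
    exact ⟨A, fun t ht => (D.twistEq_iff ht).2 (funext fun k => hA k t ht)⟩

theorem trace_inv_mul_matPd_matPd (ht : t ∈ U) (i j : Fin 2) :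
    ((H t)⁻¹ * matPd j (matPd i H) t).trace = 2 * pd j (radLogDeriv H i) t + quadTrace H j i t := by
  rw [D.pd_radLogDeriv ht]
  ring

theorem jet_ricci_inl_self (ht : t ∈ U) (i : Fin 2) :
    (D.jet ht).ricci (.inl i) (.inl i) = pd i q t / q t * radLogDeriv H i t
      - (pd i (radLogDeriv H i) t + quadTrace H i i t / 4) := by
  have quad : ((H t)⁻¹ * matPd i H t * (H t)⁻¹ * matPd i H t).trace = quadTrace H i i t := by
    rw [Matrix.mul_assoc, quadTrace, logDeriv]
  rw [KillingJet.ricci_inl_self]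
  simp only [jet, D.trace_inv_mul_matPd_matPd ht, quad, radLogDeriv, logDeriv]
  ring

theorem ricci_inl_self_eq_zero_iff (ht : t ∈ U) {i : Fin 2} (hρ : radLogDeriv H i t ≠ 0) :
    (D.jet ht).ricci (.inl i) (.inl i) = 0 ↔ ScalarEq H q i t := by
  rw [D.jet_ricci_inl_self ht, ScalarEq, D.pd_log_q ht, D.scalarRhs_eq ht hρ, eq_div_iff hρ,
    sub_eq_zero]

theorem mul_mixedResidual (ht : t ∈ U) :
    H t * mixedResidual Λ H q A t
      = (2 : ℝ) • matPd 0 (matPd 1 H) t - matPd 0 H t * (H t)⁻¹ * matPd 1 H t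
        - matPd 1 H t * (H t)⁻¹ * matPd 0 H t
        + radLogDeriv H 1 t • matPd 0 H t + radLogDeriv H 0 t • matPd 1 H t
        + (2 * Λ * q t) • H t + (q t / (H t).det) • Matrix.vecMulVec A A := by
  have hH := D.isUnit_det ht
  rw [mixedResidual, D.matPd_logDeriv ht, D.matPd_logDeriv ht, matPd_comm D.isOpen D.smooth ht]
  simp only [logDeriv, Matrix.mul_add, Matrix.mul_sub, Matrix.mul_smul, Matrix.mul_one,
    Matrix.mul_assoc, Matrix.mul_nonsing_inv_cancel_left _ _ hH]
  module

theorem ricci_inr_inr_eq_iff (ht : t ∈ U) (h : TwistEq H F q A t) :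
    (∀ k l, (D.jet ht).ricci (.inr k) (.inr l) = Λ * H t k l) ↔ MatrixEq Λ H q A t := by
  have hq := D.q_ne_zero t ht
  have residual (k l : Fin 2) : (D.jet ht).ricci (.inr k) (.inr l) - Λ * H t k l
      = -(1 / (2 * q t)) * (H t * mixedResidual Λ H q A t) k l := by
    rw [KillingJet.ricci_inr_inr, D.mul_mixedResidual ht, D.jet_twist_of_twistEq ht h,
      ← D.rad_sq ht]
    simp only [jet, Pi.smul_apply, Matrix.add_apply, Matrix.sub_apply, Matrix.smul_apply,
      smul_eq_mul, Matrix.vecMulVec_apply, radLogDeriv, logDeriv]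
    field_simp
    ring
  have hH := (Matrix.isUnit_iff_isUnit_det _).2 (D.isUnit_det ht)
  rw [D.matrixEq_iff ht, ← hH.mul_right_eq_zero, ← Matrix.ext_iff]
  refine forall₂_congr fun k l => ?_
  rw [← sub_eq_zero, residual, mul_eq_zero_iff_left (by simp [hq]), Matrix.zero_apply]

theorem ricci_inl_zero_inl_one (hρ : ∀ s ∈ U, radLogDeriv H 0 s ≠ 0)
    (h : ReducedSystem Λ H F q A U) (ht : t ∈ U) :
    (D.jet ht).ricci (.inl 0) (.inl 1) = Λ * q t := by
  have hq := D.q_ne_zero t ht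
  have residual_deriv (i : Fin 2) : matPd i (matrixResidual Λ H q A) t = 0 :=
    (matPd_congr_on D.isOpen (fun s hs => (D.matrixResidual_eq_zero_iff hs).2
      ((D.matrixEq_iff hs).1 (h s hs).1)) ht).trans (matPd_const 0)
  have log_q_deriv : pd 1 (pd 0 (fun s => Real.log (q s))) t
      = -pd 1 (radLogDeriv H 0) t - quadTrace H 0 1 t / 4
        + q t * (2 * twistPotential H Λ A t - 3 * Λ) := by
    rw [pd_congr_on D.isOpen (fun s hs => (h s hs).2.1) ht]
    exact D.pd_scalarRhs ht zero_ne_one hρ (h t ht).1 (residual_deriv 0) (h t ht).2.1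
  have twist_norm : (D.jet ht).twist ⬝ᵥ (H t)⁻¹ *ᵥ (D.jet ht).twist
      = 4 * q t ^ 2 * (twistPotential H Λ A t - Λ) := by
    rw [D.jet_twist_of_twistEq ht (h t ht).2.2.2, Matrix.mulVec_smul, smul_dotProduct,
      dotProduct_smul, twistPotential, ← D.rad_sq ht]
    simp only [smul_eq_mul]
    field_simp
    ring
  have quad : ((H t)⁻¹ * matPd 0 H t * (H t)⁻¹ * matPd 1 H t).trace = quadTrace H 0 1 t := by
    rw [Matrix.mul_assoc, quadTrace, logDeriv, logDeriv]
  have jet_K : (D.jet ht).K = (H t)⁻¹ := rfl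
  rw [D.pd_pd_log_q ht] at log_q_deriv
  rw [KillingJet.ricci_inl_zero_inl_one, jet_K, twist_norm]
  simp only [jet, D.trace_inv_mul_matPd_matPd ht, quad, pd_comm D.isOpen D.smooth_q ht (i := 0),
    D.pd_radLogDeriv_comm ht 1 0]
  linear_combination (norm := (field_simp; ring)) -log_q_deriv

theorem isLambdaVacuum_iff (hUc : IsPreconnected U) (hρ : ∀ i, ∀ t ∈ U, radLogDeriv H i t ≠ 0) :
    IsLambdaVacuum Λ (metric (nullForm q) H F) (proj ⁻¹' U)
      ↔ ∃ A, ReducedSystem Λ H F q A U := by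
  have vacuum_iff : IsLambdaVacuum Λ (metric (nullForm q) H F) (proj ⁻¹' U)
      ↔ ∀ t (ht : t ∈ U) μ ν, (D.jet ht).ricci μ ν
          = Λ * Matrix.fromBlocks (nullForm q t) 0 0 (H t) μ ν := by
    refine ⟨fun h t ht => ?_, fun h x hx => (D.ricci_eq_smul_metric_iff Λ hx rfl).2 (h _ hx)⟩
    have lift : proj (Sum.elim t 0) = t := rfl
    exact (D.ricci_eq_smul_metric_iff Λ ht lift).1 (h _ ht)
  rw [vacuum_iff]
  constructor
  · intro h
    obtain ⟨A, hA⟩ := (D.exists_twistEq_iff hUc).2 fun t ht e k => by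
      simpa using h t ht (.inl e) (.inr k)
    have scalar (t) (ht : t ∈ U) (i : Fin 2) : ScalarEq H q i t := by
      refine (D.ricci_inl_self_eq_zero_iff ht (hρ i t ht)).1 ((h t ht _ _).trans ?_)
      fin_cases i <;> simp [nullForm]
    exact ⟨A, fun t ht => ⟨(D.ricci_inr_inr_eq_iff ht (hA t ht)).1 fun k l => h t ht _ _,
      scalar t ht 0, scalar t ht 1, hA t ht⟩⟩
  · rintro ⟨A, h⟩ t ht
    obtain ⟨hmatrix, hscalar₀, hscalar₁, htwist⟩ := h t ht
    have mixed (i k : Fin 2) : (D.jet ht).ricci (.inl i) (.inr k) = 0 :=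
      (D.exists_twistEq_iff hUc).1 ⟨A, fun s hs => (h s hs).2.2.2⟩ t ht i k
    have diag₀ := (D.ricci_inl_self_eq_zero_iff ht (hρ 0 t ht)).2 hscalar₀
    have diag₁ := (D.ricci_inl_self_eq_zero_iff ht (hρ 1 t ht)).2 hscalar₁
    have offDiag₀₁ := D.ricci_inl_zero_inl_one (hρ 0) h ht
    have offDiag₁₀ := (KillingJet.ricci_comm _ _ _).trans offDiag₀₁
    rintro (i | k) (j | l)
    · fin_cases i <;> fin_cases j <;> simp [nullForm, diag₀, diag₁, offDiag₀₁, offDiag₁₀]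
    · simpa using mixed i l
    · simpa using (KillingJet.ricci_comm _ _ _).trans (mixed j k)
    · exact (D.ricci_inr_inr_eq_iff ht htwist).2 hmatrix k l

end IsKillingData

/-! ### Integrability of the orthogonal distribution -/

section Frobenius

variable {ι : Type*} [Fintype ι] {x : ι → ℝ} {X Y : (ι → ℝ) → ι → ℝ}

theorem fderiv_lieBracket_eq_zero {E : Type*} [NormedAddCommGroup E] [NormedSpace ℝ E]
    {f : (ι → ℝ) → E} (hf : ContDiffAt ℝ 2 f x) (hX : DifferentiableAt ℝ X x)
    (hY : DifferentiableAt ℝ Y x) (hfX : ∀ᶠ s in 𝓝 x, fderiv ℝ f s (X s) = 0)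
    (hfY : ∀ᶠ s in 𝓝 x, fderiv ℝ f s (Y s) = 0) :
    fderiv ℝ f x (VectorField.lieBracket ℝ X Y x) = 0 := by
  have hf' : DifferentiableAt ℝ (fderiv ℝ f) x :=
    (hf.fderiv_right (m := 1) one_add_one_eq_two.le).differentiableAt one_ne_zero
  have deriv_eq {Z : (ι → ℝ) → ι → ℝ} (hZ : DifferentiableAt ℝ Z x)
      (hfZ : ∀ᶠ s in 𝓝 x, fderiv ℝ f s (Z s) = 0) (v : ι → ℝ) :
      fderiv ℝ f x (fderiv ℝ Z x v) = -fderiv ℝ (fderiv ℝ f) x v (Z x) := by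
    have h := DFunLike.congr_fun (fderiv_clm_apply hf' hZ) v
    rw [EventuallyEq.fderiv_eq (f := fun _ => (0 : E)) hfZ, fderiv_fun_const] at h
    exact eq_neg_of_add_eq_zero_left h.symm
  have hsymm : IsSymmSndFDerivAt ℝ f x := hf.isSymmSndFDerivAt (by simp)
  rw [VectorField.lieBracket, map_sub, deriv_eq hY hfY, deriv_eq hX hfX, hsymm.eq, sub_self]

theorem IsCompletelyIntegrable.congr {M : Set (ι → ℝ)} {D D' : (ι → ℝ) → Submodule ℝ (ι → ℝ)}
    (h : IsCompletelyIntegrable M D) (hDD' : Set.EqOn D D' M) : IsCompletelyIntegrable M D' := by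
  intro p hp
  obtain ⟨V, hV, hpV, hVM, m, y, hy, hD⟩ := h p hp
  exact ⟨V, hV, hpV, hVM, m, y, hy, fun x hx =>
    ⟨(hD x hx).1, (hDD' (hVM hx)).symm.trans (hD x hx).2⟩⟩

theorem IsCompletelyIntegrable.lieBracket_mem {M : Set (ι → ℝ)}
    {D : (ι → ℝ) → Submodule ℝ (ι → ℝ)} (h : IsCompletelyIntegrable M D)
    (hx : x ∈ M) (hX : DifferentiableAt ℝ X x) (hY : DifferentiableAt ℝ Y x)
    (hXD : ∀ s ∈ M, X s ∈ D s) (hYD : ∀ s ∈ M, Y s ∈ D s) :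
    VectorField.lieBracket ℝ X Y x ∈ D x := by
  obtain ⟨V, hV, hxV, hVM, m, y, hy, hD⟩ := h x hx
  have annihilates {Z : (ι → ℝ) → ι → ℝ} (hZD : ∀ s ∈ M, Z s ∈ D s) :
      ∀ᶠ s in 𝓝 x, fderiv ℝ y s (Z s) = 0 := by
    filter_upwards [hV.mem_nhds hxV] with s hs
    exact LinearMap.mem_ker.1 ((hD s hs).2 ▸ hZD s (hVM hs))
  rw [(hD x hxV).2]
  have hy₂ : ContDiffAt ℝ 2 y x := (hy.contDiffAt (hV.mem_nhds hxV)).of_le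
    (WithTop.coe_le_coe.2 le_top)
  exact fderiv_lieBracket_eq_zero hy₂ hX hY (annihilates hXD) (annihilates hYD)

variable [DecidableEq ι]

theorem lieBracket_apply (hX : DifferentiableAt ℝ X x) (hY : DifferentiableAt ℝ Y x) (a : ι) :
    VectorField.lieBracket ℝ X Y x a
      = ∑ b, (X x b * pd b (fun s => Y s a) x - Y x b * pd b (fun s => X s a) x) := by
  have component {Z : (ι → ℝ) → ι → ℝ} (hZ : DifferentiableAt ℝ Z x) (v : ι → ℝ) :
      fderiv ℝ Z x v a = ∑ b, v b * pd b (fun s => Z s a) x := by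
    rw [← fderiv_eq_sum_pd, fderiv_apply hZ]
    rfl
  rw [VectorField.lieBracket, Pi.sub_apply, component hY, component hX, Finset.sum_sub_distrib]

theorem exists_primitive {B : Set (ι → ℝ)} (hconvex : Convex ℝ B) (hB : IsOpen B)
    {η : ι → (ι → ℝ) → ℝ} (hη : ∀ i, ContDiffOn ℝ ∞ (η i) B)
    (hclosed : ∀ s ∈ B, ∀ i j, pd j (η i) s = pd i (η j) s) :
    ∃ φ : (ι → ℝ) → ℝ, ContDiffOn ℝ ∞ φ B ∧ ∀ s ∈ B, ∀ i, pd i φ s = η i s := by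
  let form (s : ι → ℝ) : (ι → ℝ) →L[ℝ] ℝ := ∑ i, η i s • ContinuousLinearMap.proj i
  have hform : ContDiffOn ℝ ∞ form B :=
    ContDiffOn.sum fun i _ => (hη i).fun_smul contDiffOn_const
  have fderiv_form {s : ι → ℝ} (hs : s ∈ B) (v w : ι → ℝ) :
      fderiv ℝ form s v w = ∑ i, ∑ j, v j * pd j (η i) s * w i := by
    have hη' (i : ι) : HasFDerivAt (η i) (fderiv ℝ (η i) s) s :=
      (((hη i).contDiffAt (hB.mem_nhds hs)).differentiableAt (by simp)).hasFDerivAt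
    have hform' := HasFDerivAt.fun_sum (u := Finset.univ) fun i _ =>
      (hη' i).smul_const (ContinuousLinearMap.proj i : (ι → ℝ) →L[ℝ] ℝ)
    simp [form, hform'.fderiv, fderiv_eq_sum_pd, Finset.sum_mul]
  obtain ⟨φ, hφ⟩ := hconvex.exists_forall_hasFDerivAt_of_fderiv_symmetric hB
    (hform.differentiableOn (by simp)) fun s hs v w => by
      rw [fderiv_form hs, fderiv_form hs, Finset.sum_comm]
      refine Fintype.sum_congr _ _ fun i => Fintype.sum_congr _ _ fun j => ?_
      rw [hclosed s hs i j]
      ring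
  refine ⟨φ, ?_, fun s hs i => ?_⟩
  · rw [contDiffOn_infty_iff_fderiv_of_isOpen hB]
    exact ⟨fun s hs => (hφ s hs).differentiableAt.differentiableWithinAt,
      hform.congr fun s hs => (hφ s hs).fderiv⟩
  · simp [pd, (hφ s hs).fderiv, form, Pi.single_apply]

end Frobenius

section OrthDistribution

variable {gt H F : (Fin 2 → ℝ) → Matrix (Fin 2) (Fin 2) ℝ} {U : Set (Fin 2 → ℝ)}
  {x : Fin 2 ⊕ Fin 2 → ℝ}

/-- The pair of forms `dzᵏ + f_iᵏ dtⁱ` at a point where `F = C`. -/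
def vertForm (C : Matrix (Fin 2) (Fin 2) ℝ) : (Fin 2 ⊕ Fin 2 → ℝ) →L[ℝ] Fin 2 → ℝ :=
  ContinuousLinearMap.pi fun k => .proj (.inr k) + ∑ i, C i k • .proj (.inl i)

theorem vertForm_apply (C : Matrix (Fin 2) (Fin 2) ℝ) (v : Fin 2 ⊕ Fin 2 → ℝ) (k : Fin 2) :
    vertForm C v k = v (.inr k) + ∑ i, C i k * v (.inl i) := by
  simp [vertForm]

theorem surjective_vertForm (C : Matrix (Fin 2) (Fin 2) ℝ) : Function.Surjective (vertForm C) :=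
  fun c => ⟨Sum.elim 0 c, funext fun k => by simp [vertForm_apply]⟩

theorem mem_orthDistribution_iff (g : (Fin 2 ⊕ Fin 2 → ℝ) → Matrix (Fin 2 ⊕ Fin 2) _ ℝ)
    (v : Fin 2 ⊕ Fin 2 → ℝ) : v ∈ orthDistribution g x ↔ ∀ k, (g x *ᵥ v) (.inr k) = 0 := by
  rw [orthDistribution, LinearMap.BilinForm.mem_orthogonal_iff, killingSpan]
  constructor
  · intro h k
    simpa [Matrix.toBilin'_apply'] using
      h _ (Submodule.subset_span ⟨k, rfl⟩)
  · intro h w hw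
    have span_le : Submodule.span ℝ (Set.range fun k : Fin 2 => Pi.single (Sum.inr k) 1)
        ≤ LinearMap.ker ((Matrix.toBilin' (g x)).flip v) := by
      rw [Submodule.span_le]
      rintro _ ⟨k, rfl⟩
      simp [Matrix.toBilin'_apply', h k]
    exact span_le hw

theorem orthDistribution_metric (hsymm : (H (proj x)).IsSymm) (hdet : IsUnit (H (proj x)).det) :
    orthDistribution (metric gt H F) x = LinearMap.ker (vertForm (F (proj x))).toLinearMap := by
  ext v
  have lower : (fun k => (metric gt H F x *ᵥ v) (.inr k))
      = H (proj x) *ᵥ vertForm (F (proj x)) v := by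
    have vertForm_eq : vertForm (F (proj x)) v = (F (proj x))ᵀ *ᵥ (v ∘ .inl) + v ∘ .inr :=
      funext fun k => (vertForm_apply _ _ _).trans (add_comm _ _)
    rw [vertForm_eq, metric, Matrix.fromBlocks_mulVec, Matrix.transpose_mul, hsymm.eq,
      Matrix.mulVec_add, Matrix.mulVec_mulVec]
    rfl
  have injective := Matrix.mulVec_injective_iff_isUnit.2 ((Matrix.isUnit_iff_isUnit_det _).2 hdet)
  rw [mem_orthDistribution_iff, ← funext_iff (g := fun _ => 0), lower]
  exact injective.eq_iff' (Matrix.mulVec_zero _)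

/-- The lift of `∂/∂tⁱ` to the kernel of the forms `dzᵏ + f_iᵏ dtⁱ`. -/
def horizontalLift (F : (Fin 2 → ℝ) → Matrix (Fin 2) (Fin 2) ℝ) (i : Fin 2)
    (x : Fin 2 ⊕ Fin 2 → ℝ) : Fin 2 ⊕ Fin 2 → ℝ :=
  Sum.elim (Pi.single i 1) (fun k => -F (proj x) i k)

theorem vertForm_horizontalLift (i : Fin 2) :
    vertForm (F (proj x)) (horizontalLift F i x) = 0 := by
  ext k
  simp [vertForm_apply, horizontalLift, Pi.single_apply]

theorem differentiableAt_horizontalLift (hF : MatDifferentiableAt F (proj x)) (i : Fin 2) :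
    DifferentiableAt ℝ (horizontalLift F i) x := by
  rw [differentiableAt_pi]
  rintro (a | k)
  · exact differentiableAt_const _
  · exact ((hF i k).comp x (contDiff_proj.differentiable (by simp) x)).neg

theorem lieBracket_horizontalLift (hF : MatDifferentiableAt F (proj x)) (i j : Fin 2) :
    VectorField.lieBracket ℝ (horizontalLift F i) (horizontalLift F j) x
      = Sum.elim (0 : Fin 2 → ℝ) (fun k => matPd j F (proj x) i k - matPd i F (proj x) j k) := by
  have pd_inl (l a : Fin 2) (b) : pd b (fun s => horizontalLift F l s (.inl a)) x = 0 :=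
    pd_const _
  have pd_inr (l k : Fin 2) (b) : pd b (fun s => horizontalLift F l s (.inr k)) x
      = -Sum.elim (fun i => matPd i F (proj x)) 0 b l k := by
    rw [← matPd_comp_proj hF]
    simp [pd, matPd, horizontalLift, fderiv_fun_neg]
  ext (a | k) <;> rw [lieBracket_apply (differentiableAt_horizontalLift hF i)
    (differentiableAt_horizontalLift hF j)]
  · simp [pd_inl]
  · simp only [pd_inr, Finset.sum_sub_distrib]
    simp [horizontalLift, Pi.single_apply, ← sub_eq_neg_add]

theorem fderiv_primitive_eq_vertForm {φ : Fin 2 → (Fin 2 → ℝ) → ℝ}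
    (hφ : ∀ k, DifferentiableAt ℝ (φ k) (proj x))
    (hpd : ∀ i k, pd i (φ k) (proj x) = F (proj x) i k) :
    fderiv ℝ (fun s k => s (.inr k) + φ k (proj s)) x = vertForm (F (proj x)) := by
  let proj' : (Fin 2 ⊕ Fin 2 → ℝ) →L[ℝ] Fin 2 → ℝ := .pi fun i => .proj (.inl i)
  have component (k : Fin 2) : HasFDerivAt (fun s : Fin 2 ⊕ Fin 2 → ℝ => s (.inr k) + φ k (proj s))
      (.proj (.inr k) + (fderiv ℝ (φ k) (proj x)).comp proj') x :=
    (hasFDerivAt_apply (.inr k) x).add ((hφ k).hasFDerivAt.comp x proj'.hasFDerivAt)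
  rw [(hasFDerivAt_pi.2 component).fderiv]
  ext v k
  simp [vertForm_apply, fderiv_eq_sum_pd, hpd, proj', mul_comm]

theorem isCompletelyIntegrable_ker_vertForm (hU : IsOpen U) (hF : MatSmoothOn F U)
    (hclosed : ∀ t ∈ U, ∀ i j k, matPd j F t i k = matPd i F t j k) :
    IsCompletelyIntegrable (proj ⁻¹' U)
      (fun x => LinearMap.ker (vertForm (F (proj x))).toLinearMap) := by
  intro p hp
  obtain ⟨ε, hε, hball⟩ := Metric.isOpen_iff.1 hU _ hp
  have hB : IsOpen (Metric.ball (proj p) ε) := Metric.isOpen_ball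
  choose φ hφ hpd using fun k => exists_primitive (convex_ball (proj p) ε) hB
    (fun i => (hF i k).mono hball) (fun s hs i j => hclosed s (hball hs) i j k)
  refine ⟨proj ⁻¹' Metric.ball (proj p) ε, isOpen_preimage_proj hB, Metric.mem_ball_self hε,
    Set.preimage_mono hball, 2, fun x k => x (.inr k) + φ k (proj x), ?_, fun x hx => ?_⟩
  · exact contDiffOn_pi.2 fun k => (contDiff_apply ℝ ℝ (Sum.inr k)).contDiffOn.add
      ((hφ k).comp contDiff_proj.contDiffOn fun _ h => h)
  · have hφ' (k : Fin 2) : DifferentiableAt ℝ (φ k) (proj x) :=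
      ((hφ k).contDiffAt (hB.mem_nhds hx)).differentiableAt (by simp)
    rw [fderiv_primitive_eq_vertForm hφ' fun i k => hpd k _ hx i]
    exact ⟨surjective_vertForm _, rfl⟩

theorem matPd_comm_of_isCompletelyIntegrable_ker_vertForm (hU : IsOpen U) (hF : MatSmoothOn F U)
    (h : IsCompletelyIntegrable (proj ⁻¹' U)
      (fun x => LinearMap.ker (vertForm (F (proj x))).toLinearMap))
    {t : Fin 2 → ℝ} (ht : t ∈ U) (i j k : Fin 2) : matPd j F t i k = matPd i F t j k := by
  have hF' : MatDifferentiableAt F (proj (Sum.elim t 0)) := hF.matDifferentiableAt hU ht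
  have bracket := h.lieBracket_mem (x := Sum.elim t 0) ht (differentiableAt_horizontalLift hF' i)
    (differentiableAt_horizontalLift hF' j) (fun _ _ => vertForm_horizontalLift i)
    (fun _ _ => vertForm_horizontalLift j)
  rw [lieBracket_horizontalLift hF'] at bracket
  have vertical : vertForm _ _ k = 0 := congrFun (LinearMap.mem_ker.1 bracket) k
  have proj_elim : proj (Sum.elim t 0) = t := rfl
  simpa [vertForm_apply, proj_elim, sub_eq_zero] using vertical

end OrthDistribution

namespace IsKillingData

variable {U : Set (Fin 2 → ℝ)} {H F : (Fin 2 → ℝ) → Matrix (Fin 2) (Fin 2) ℝ}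
  {q : (Fin 2 → ℝ) → ℝ} (D : IsKillingData U H q F) {t : Fin 2 → ℝ} {Λ : ℝ} {A : Fin 2 → ℝ}
include D

theorem isCompletelyIntegrable_iff :
    IsCompletelyIntegrable (proj ⁻¹' U) (orthDistribution (metric (nullForm q) H F))
      ↔ ∀ t ∈ U, ∀ i j k, matPd j F t i k = matPd i F t j k := by
  have eqOn_ker : Set.EqOn (orthDistribution (metric (nullForm q) H F))
      (fun x => LinearMap.ker (vertForm (F (proj x))).toLinearMap) (proj ⁻¹' U) :=
    fun x hx => orthDistribution_metric (D.symm _ hx) (D.isUnit_det hx)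
  exact ⟨fun h _ => matPd_comm_of_isCompletelyIntegrable_ker_vertForm D.isOpen D.smooth_F
      (h.congr eqOn_ker),
    fun h => (isCompletelyIntegrable_ker_vertForm D.isOpen D.smooth_F h).congr eqOn_ker.symm⟩

theorem eq_zero_iff_of_twistEq (ht : t ∈ U) (h : TwistEq H F q A t) :
    A = 0 ↔ ∀ i j k, matPd j F t i k = matPd i F t j k := by
  have twist_eq : (fun k => matPd 1 F t 0 k - matPd 0 F t 1 k) = (q t / rad H t) • (A ᵥ* (H t)⁻¹) :=
    h
  have hcoeff : q t / rad H t ≠ 0 := div_ne_zero (D.q_ne_zero t ht) (D.rad_pos ht).ne'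
  have injective : Function.Injective fun v => v ᵥ* (H t)⁻¹ :=
    Matrix.vecMul_injective_iff_isUnit.2
      ((Matrix.isUnit_iff_isUnit_det _).2 (Matrix.isUnit_nonsing_inv_det _ (D.isUnit_det ht)))
  have eq_zero_iff : A = 0 ↔ ∀ k, matPd 1 F t 0 k = matPd 0 F t 1 k := by
    rw [← injective.eq_iff' (Matrix.zero_vecMul _), ← smul_eq_zero_iff_right hcoeff, ← twist_eq,
      funext_iff]
    simp only [Pi.zero_apply, sub_eq_zero]
  rw [eq_zero_iff]
  refine ⟨fun h i j k => ?_, fun h => h 0 1⟩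
  fin_cases i <;> fin_cases j
  exacts [rfl, h k, (h k).symm, rfl]

theorem eq_zero_iff_isCompletelyIntegrable (hne : U.Nonempty) (h : ∀ t ∈ U, TwistEq H F q A t) :
    A = 0 ↔ IsCompletelyIntegrable (proj ⁻¹' U)
      (orthDistribution (metric (nullForm q) H F)) := by
  rw [D.isCompletelyIntegrable_iff]
  obtain ⟨t₀, ht₀⟩ := hne
  exact ⟨fun hA t ht => (D.eq_zero_iff_of_twistEq ht (h t ht)).1 hA,
    fun hclosed => (D.eq_zero_iff_of_twistEq ht₀ (h t₀ ht₀)).2 (hclosed t₀ ht₀)⟩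

end IsKillingData

end G2Metric

end

theorem mainTheorem10 (Λ : ℝ) (U : Set (Fin 2 → ℝ)) (hU : IsOpen U) (hUc : IsConnected U)
    (H F : (Fin 2 → ℝ) → Matrix (Fin 2) (Fin 2) ℝ) (q : (Fin 2 → ℝ) → ℝ)
    (hH : ∀ k l, ContDiffOn ℝ ∞ (fun t => H t k l) U)
    (hF : ∀ i k, ContDiffOn ℝ ∞ (fun t => F t i k) U)
    (hq : ContDiffOn ℝ ∞ q U)
    (hHsymm : ∀ t ∈ U, (H t).IsSymm)
    (hHdet : ∀ t ∈ U, 0 < (H t).det)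
    (hq0 : ∀ t ∈ U, q t ≠ 0)
    (hC : ∀ t ∈ U, G2Metric.cRho (G2Metric.nullForm q) H t ≠ 0) :
    (G2Metric.IsLambdaVacuum Λ (G2Metric.metric (G2Metric.nullForm q) H F)
        {x | G2Metric.proj x ∈ U} ↔
      ∃ A : Fin 2 → ℝ, G2Metric.ReducedSystem Λ H F q A U) ∧
    (∀ A : Fin 2 → ℝ, G2Metric.ReducedSystem Λ H F q A U →
      (A = 0 ↔ G2Metric.IsCompletelyIntegrable {x | G2Metric.proj x ∈ U}
        (G2Metric.orthDistribution (G2Metric.metric (G2Metric.nullForm q) H F)))) ∧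
    (∀ A : Fin 2 → ℝ, ∀ t ∈ U, G2Metric.CompatibleAt Λ H q A t) ∧
    (∀ A : Fin 2 → ℝ, ∀ t ∈ U, G2Metric.MatrixEq Λ H q A t →
      G2Metric.pd 1 (G2Metric.pd 0 (G2Metric.rad H)) t
        = -Λ * q t * G2Metric.rad H t
          - q t / (4 * G2Metric.rad H t) * (A ⬝ᵥ ((H t)⁻¹ *ᵥ A))) := by
  have D : G2Metric.IsKillingData U H q F := ⟨⟨⟨hU, hH, hHsymm, hHdet⟩, hq, hq0⟩, hF⟩
  have hρ (i : Fin 2) (t : Fin 2 → ℝ) (ht : t ∈ U) : G2Metric.radLogDeriv H i t ≠ 0 :=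
    D.radLogDeriv_ne_zero ht (hC t ht) i
  exact ⟨D.isLambdaVacuum_iff hUc.isPreconnected hρ,
    fun A hA => D.eq_zero_iff_isCompletelyIntegrable hUc.nonempty fun t ht => (hA t ht).2.2.2,
    fun A t ht => D.compatibleAt ht hρ,
    fun A t ht h => D.pd_pd_rad_of_matrixEq ht h⟩
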